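/- **Proposition 3.1 (eigenfunctions).** Let $\kappa>0$ and let $D_1\subset\mathbb R^2$ be the open unit disk. Consider the clamped problem $$\Delta^2u-\kappa^2u=-\lambda\,\Delta u\ \text{ in }D_1,\qquad u=\partial_ru=0\ \text{ on }\partial D_1,\qquad (\ast)$$ with $\lambda\in\mathbb R$ and complex-valued classical solutions $u\in C^4(D_1)\cap C^1(\overline{D_1})$; an eigenfunction with eigenvalue $\lambda$ is a solution $u\neq0$. Let $J_n$ and $I_n$ be the Bessel and the modified Bessel function of the first kind of order $n$. For $k\in\mathbb Z$, $\alpha>0$ and $c,d\in\mathbb R$ put $$F_k(\alpha)=\frac{\kappa}{\alpha}J_{|k|}(\alpha)\,I_{|k|}'\!\Bigl(\frac{\kappa}{\alpha}\Bigr)-\alpha\, I_{|k|}\!\Bigl(\frac{\kappa}{\alpha}\Bigr)J_{|k|}'(\alpha),\qquad R(r)=R_{k,\alpha,c,d}(r)=c\,J_{|k|}(\alpha r)+d\,I_{|k|}\!\Bigl(\frac{\kappa}{\alpha}r\Bigr).$$ 1. For $k\in\mathbb Z$ and $\alpha>0$, there is $(c,d)\in\mathbb R^2\setminus\{(0,0)\}$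 with $R(1)=R'(1)=0$ if and only if $F_k(\alpha)=0$. 2. For $k\in\mathbb Z$, $\alpha>0$, $(c,d)\in\mathbb R^2\setminus\{(0,0)\}$ and $\lambda\in\mathbb R$, the function $R(r)e^{ik\theta}$ is an eigenfunction of $(\ast)$ with eigenvalue $\lambda$ if and only if $R(1)=R'(1)=0$ and $\lambda=\alpha^2-\kappa^2/\alpha^2$. 3. Every eigenfunction of $(\ast)$ of the form $\rho(r)e^{ik\theta}$ with $k\in\mathbb Z$ and $\rho$ real-valued on $[0,1]$ has $\rho=R_{k,\alpha,c,d}$ for some $\alpha>0$ with $F_k(\alpha)=0$ and some $(c,d)\in\mathbb R^2\setminus\{(0,0)\}$, and its eigenvalue is $\lambda=\alpha^2-\kappa^2/\alpha^2$. 4. There are no other eigenfunctions up to linear combination: for each $\lambda\in\mathbb R$, the eigenfunctions with eigenvalue $\lambda$ are exactly the nonzero functions on $\overline{D_1}$ that are finite complex linear combinations of eigenfunctions $R_{k,\alpha,c_k,d_k}(r)e^{ik\theta}$ with eigenvalue $\lambda$, where $k\in\mathbb Z$, $c_k,d_k\in\mathbb R$, and $\alpha>0$ is the same for all terms, satisfies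 $\lambda=\alpha^2-\kappa^2/\alpha^2$, and satisfies $F_k(\alpha)=0$ for every $k$ that occurs. 5. Consequently $\lambda\in\mathbb R$ is an eigenvalue of $(\ast)$ if and only if $\lambda=\alpha^2-\kappa^2/\alpha^2$ for some $k\in\mathbb Z$ and some $\alpha>0$ with $F_k(\alpha)=0$. -/

import Mathlib

open Metric Laplacian InnerProductSpace

noncomputable section

namespace ClampedDisk

/-- The Bessel function of the first kind `J_n` (integer order `n ≥ 0`, real argument), by its
power series `∑ (-1)^m / (m! (m+n)!) (x/2)^(2m+n)`, which converges for every `x`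
(see `summable_besselJ`). -/
def besselJ (n : ℕ) (x : ℝ) : ℝ :=
  ∑' m : ℕ, (-1) ^ m / ((m.factorial : ℝ) * ((m + n).factorial : ℝ)) * (x / 2) ^ (2 * m + n)

/-- The modified Bessel function of the first kind `I_n` (integer order `n ≥ 0`, real argument),
by its power series `∑ 1 / (m! (m+n)!) (x/2)^(2m+n)`, which converges for every `x`
(see `summable_besselI`). -/
def besselI (n : ℕ) (x : ℝ) : ℝ :=
  ∑' m : ℕ, 1 / ((m.factorial : ℝ) * ((m + n).factorial : ℝ)) * (x / 2) ^ (2 * m + n)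

theorem summable_besselI (n : ℕ) (x : ℝ) :
    Summable fun m : ℕ =>
      1 / ((m.factorial : ℝ) * ((m + n).factorial : ℝ)) * (x / 2) ^ (2 * m + n) := by
  refine Summable.of_norm_bounded
    (g := fun m : ℕ => |x / 2| ^ n * (((x / 2) ^ 2) ^ m / (m.factorial : ℝ)))
    ((Real.summable_pow_div_factorial ((x / 2) ^ 2)).mul_left _) fun m => ?_
  have h1 : (1 : ℝ) ≤ ((m + n).factorial : ℝ) := by
    exact_mod_cast Nat.succ_le_of_lt (Nat.factorial_pos _)
  have h0 : (0 : ℝ) < (m.factorial : ℝ) := by exact_mod_cast Nat.factorial_pos _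
  have e : |x / 2| ^ (2 * m + n) = |x / 2| ^ n * ((x / 2) ^ 2) ^ m := by
    rw [← sq_abs (x / 2), ← pow_mul, ← pow_add, add_comm]
  rw [norm_mul, norm_pow, Real.norm_eq_abs, Real.norm_eq_abs, e,
    abs_of_pos (by positivity : (0 : ℝ) < 1 / ((m.factorial : ℝ) * ((m + n).factorial : ℝ)))]
  have h2 : 1 / ((m.factorial : ℝ) * ((m + n).factorial : ℝ)) ≤ 1 / (m.factorial : ℝ) :=
    one_div_le_one_div_of_le h0 (le_mul_of_one_le_right h0.le h1)
  calc 1 / ((m.factorial : ℝ) * ((m + n).factorial : ℝ)) * (|x / 2| ^ n * ((x / 2) ^ 2) ^ m)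
      ≤ 1 / (m.factorial : ℝ) * (|x / 2| ^ n * ((x / 2) ^ 2) ^ m) := by gcongr
    _ = _ := by ring

theorem summable_besselJ (n : ℕ) (x : ℝ) :
    Summable fun m : ℕ =>
      (-1) ^ m / ((m.factorial : ℝ) * ((m + n).factorial : ℝ)) * (x / 2) ^ (2 * m + n) := by
  refine Summable.of_norm_bounded (summable_besselI n x).norm fun m => le_of_eq ?_
  simp [norm_mul, norm_div]

/-- The characteristic function
`F_k(α) = (κ/α) J_{|k|}(α) I'_{|k|}(κ/α) - α I_{|k|}(κ/α) J'_{|k|}(α)`. -/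
def charF (κ : ℝ) (k : ℤ) (α : ℝ) : ℝ :=
  κ / α * besselJ k.natAbs α * deriv (besselI k.natAbs) (κ / α)
    - α * besselI k.natAbs (κ / α) * deriv (besselJ k.natAbs) α

/-- The radial profile `R(r) = c J_{|k|}(α r) + d I_{|k|}(κ r / α)`. -/
def radial (κ : ℝ) (k : ℤ) (α c d r : ℝ) : ℝ :=
  c * besselJ k.natAbs (α * r) + d * besselI k.natAbs (κ / α * r)

/-- The function `R(r) e^{ikθ}` of the point `z = r e^{iθ}` of the plane, where
`R(r) = c J_{|k|}(α r) + d I_{|k|}(κ r / α)`. The plane `ℝ²` is identified with `ℂ`. -/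
def mode (κ : ℝ) (k : ℤ) (α c d : ℝ) (z : ℂ) : ℂ :=
  (radial κ k α c d ‖z‖ : ℂ) * Complex.exp (Complex.I * (k : ℂ) * (Complex.arg z : ℂ))

/-- `u` is a (complex-valued, classical) solution of the clamped problem
`Δ²u - κ² u = -λ Δu` in the open unit disk, `u = ∂ᵣu = 0` on the unit circle:
`u` is four times continuously differentiable in the open disk and continuously differentiable
up to the boundary. Only the values of `u` on the closed disk matter. `Δ` is the Laplacian of the
real plane `ℂ = ℝ²`, and `∂ᵣu` at a point `z` of the circle is the derivative of `u` in the
direction `z`. -/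
structure IsSolution (κ lam : ℝ) (u : ℂ → ℂ) : Prop where
  contDiffOn_ball : ContDiffOn ℝ 4 u (ball 0 1)
  contDiffOn_closedBall : ContDiffOn ℝ 1 u (closedBall 0 1)
  equation : ∀ z ∈ ball (0 : ℂ) 1, Δ (Δ u) z - (κ : ℂ) ^ 2 * u z = -(lam : ℂ) * Δ u z
  boundary : ∀ z ∈ sphere (0 : ℂ) 1, u z = 0
  boundary_radial : ∀ z ∈ sphere (0 : ℂ) 1, fderivWithin ℝ u (closedBall 0 1) z z = 0

/-- `u` is an eigenfunction of the clamped problem with eigenvalue `lam`: a solution which is not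
identically zero on the disk. -/
def IsEigenfunction (κ lam : ℝ) (u : ℂ → ℂ) : Prop :=
  IsSolution κ lam u ∧ ∃ z ∈ closedBall (0 : ℂ) 1, u z ≠ 0

/-- `lam` is an eigenvalue of the clamped problem. -/
def IsEigenvalue (κ lam : ℝ) : Prop :=
  ∃ u : ℂ → ℂ, IsEigenfunction κ lam u

end ClampedDisk

end

/-! Put `β = κ/α`. Every real `λ` equals `α² - β²` for some `α > 0`, and then the equation factors
as `(Δ + α²)(Δ - β²)u = 0`. Hence `u = (f₂ - f₁)/(α² + β²)`, where `f₁ = Δu - β²u` satisfies `Δf₁ =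
-α²f₁` and `f₂ = Δu + α²u` satisfies `Δf₂ = β²f₂` (`IsSolution.circleCoeff_eq_add`). The `k`-th
Fourier coefficient on circles of a solution of `Δf = μf` satisfies the modified Bessel equation
with parameter `μ`. Regularity at the centre excludes the singular solution, so the coefficient is a
multiple of `profile μ |k|` (`exists_circleCoeff_eq_mul_profile`). Each coefficient of `u` is
therefore a `J`-part plus an `I`-part. Since `u` is `C¹` up to the circle, the two clamped
conditions pass to the coefficients and give a 2×2 linear system whose determinant is a nonzero
multiple of `F_k(α)` (`IsSolution.exists_circleCoeff_eq`). For fixed `α` only finitely many `k`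
satisfy `F_k(α) = 0` (`finite_setOf_charF_eq_zero`), so the expansion of `u` is a finite sum, and
uniqueness of Fourier coefficients makes it an identity on the closed disk
(`IsSolution.eq_sum_mode`). Conversely, a mode is `z^|k|` or its conjugate times a smooth function
of `|z|²`, hence smooth, and it combines two eigenfunctions of `Δ` with distinct eigenvalues `-α²`
and `β²`. Their independence gives the criterion `isEigenfunction_mode_iff`. -/

namespace ClampedDisk

/-! ### The entire functions `E_n`: derivative, recurrence, positivity. -/

/-- The entire function `∑ t^m / (m! (m+n)!)`, the common core of `J_n` and `I_n`. -/
noncomputable def besselE (n : ℕ) (t : ℝ) : ℝ :=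
  ∑' m : ℕ, t ^ m / ((m.factorial : ℝ) * ((m + n).factorial : ℝ))

theorem norm_besselE_term_le (n m : ℕ) (t : ℝ) :
    ‖t ^ m / ((m.factorial : ℝ) * ((m + n).factorial : ℝ))‖ ≤ |t| ^ m / (m.factorial : ℝ) := by
  have h1 : (1 : ℝ) ≤ ((m + n).factorial : ℝ) := by
    exact_mod_cast Nat.succ_le_of_lt (Nat.factorial_pos _)
  have h0 : (0 : ℝ) < (m.factorial : ℝ) := by exact_mod_cast Nat.factorial_pos _
  rw [norm_div, norm_pow, Real.norm_eq_abs, Real.norm_eq_abs,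
    abs_of_pos (by positivity : (0 : ℝ) < (m.factorial : ℝ) * ((m + n).factorial : ℝ))]
  gcongr
  exact le_mul_of_one_le_right h0.le h1

theorem summable_besselE (n : ℕ) (t : ℝ) :
    Summable fun m : ℕ => t ^ m / ((m.factorial : ℝ) * ((m + n).factorial : ℝ)) :=
  .of_norm_bounded (Real.summable_pow_div_factorial |t|) fun m => norm_besselE_term_le n m t

/-- Termwise differentiation: cancelling `m` against `m!` and shifting the index turns the series
for `n` into that for `n + 1`. On the ball of radius `|t| + 1` the derivative terms are dominated by
a shifted exponential series. -/
theorem hasDerivAt_besselE (n : ℕ) (t : ℝ) : HasDerivAt (besselE n) (besselE (n + 1) t) t := by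
  set R : ℝ := |t| + 1
  have hR : 0 < R := by positivity
  set g' : ℕ → ℝ → ℝ := fun (m : ℕ) (s : ℝ) =>
    (m : ℝ) * s ^ (m - 1) / ((m.factorial : ℝ) * ((m + n).factorial : ℝ))
  have hsucc : ∀ m s, g' (m + 1) s =
      s ^ m / ((m.factorial : ℝ) * ((m + (n + 1)).factorial : ℝ)) := by
    intro m s
    have h0 : (m.factorial : ℝ) ≠ 0 := by exact_mod_cast Nat.factorial_ne_zero _
    have h1 : ((m + (n + 1)).factorial : ℝ) ≠ 0 := by exact_mod_cast Nat.factorial_ne_zero _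
    have e : m + 1 + n = m + (n + 1) := by ring
    simp only [g', e, Nat.factorial_succ m, Nat.add_sub_cancel]
    push_cast
    have h2 : (m : ℝ) + 1 ≠ 0 := by positivity
    field_simp
  have hzero : ∀ s, g' 0 s = 0 := fun s => by simp [g']
  have key := hasDerivAt_tsum_of_isPreconnected (𝕜 := ℝ)
    (g := fun (m : ℕ) (s : ℝ) => s ^ m / ((m.factorial : ℝ) * ((m + n).factorial : ℝ))) (g' := g')
    (u := fun m : ℕ => (m : ℝ) * R ^ (m - 1) / (m.factorial : ℝ)) (t := ball 0 R) (y₀ := t) (y := t)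
    ?_ isOpen_ball (convex_ball 0 R).isPreconnected ?_ ?_ ?_ (summable_besselE n t) ?_
  · have hs : Summable fun m => g' m t := by
      rw [← summable_nat_add_iff 1]
      simpa only [hsucc] using summable_besselE (n + 1) t
    rw [hs.tsum_eq_zero_add] at key
    simpa only [hsucc, hzero, zero_add] using! key
  · rw [← summable_nat_add_iff 1]
    refine (Real.summable_pow_div_factorial R).congr fun m => ?_
    have h0 : (m.factorial : ℝ) ≠ 0 := by exact_mod_cast Nat.factorial_ne_zero _
    have h2 : (m : ℝ) + 1 ≠ 0 := by positivity
    rw [Nat.factorial_succ, Nat.add_sub_cancel]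
    push_cast
    field_simp
  · intro m s _
    exact (hasDerivAt_pow m s).div_const _
  · intro m s hs
    have hs' : |s| < R := by simpa using hs
    have h1 : (1 : ℝ) ≤ ((m + n).factorial : ℝ) := by
      exact_mod_cast Nat.succ_le_of_lt (Nat.factorial_pos _)
    have h0 : (0 : ℝ) < (m.factorial : ℝ) := by exact_mod_cast Nat.factorial_pos _
    rw [norm_div, norm_mul, norm_pow, Real.norm_eq_abs, Real.norm_eq_abs, Real.norm_eq_abs,
      abs_of_pos (by positivity : (0 : ℝ) < (m.factorial : ℝ) * ((m + n).factorial : ℝ)),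
      abs_of_nonneg (by positivity : (0 : ℝ) ≤ m)]
    gcongr
    exact le_mul_of_one_le_right h0.le h1
  · simp [R]
  · simp [R]

theorem contDiff_besselE (j n : ℕ) : ContDiff ℝ j (besselE n) := by
  induction j generalizing n with
  | zero =>
    exact contDiff_zero.2 (continuous_iff_continuousAt.2
      fun t => (hasDerivAt_besselE n t).continuousAt)
  | succ j ih =>
    have : deriv (besselE n) = besselE (n + 1) := funext fun t => (hasDerivAt_besselE n t).deriv
    exact_mod_cast contDiff_succ_iff_deriv.2
      ⟨fun t => (hasDerivAt_besselE n t).differentiableAt, by simp, this ▸ ih (n + 1)⟩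

/-- Coefficientwise this is `m + (n + 1) = m + n + 1`. In view of `hasDerivAt_besselE` it is the
differential equation `t E'' + (n + 1) E' = E`, from which every form of Bessel's equation below
follows. -/
theorem besselE_recurrence (n : ℕ) (t : ℝ) :
    t * besselE (n + 2) t + (n + 1) * besselE (n + 1) t = besselE n t := by
  have h2 : HasSum (fun m : ℕ =>
      m * (t ^ m / ((m.factorial : ℝ) * ((m + (n + 1)).factorial : ℝ))))
      (t * besselE (n + 2) t) := by
    rw [← hasSum_nat_add_iff' 1]
    simp only [Finset.range_one, Finset.sum_singleton, Nat.cast_zero, zero_mul, sub_zero]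
    refine ((summable_besselE (n + 2) t).hasSum.mul_left t).congr_fun fun m => ?_
    have h0 : (m.factorial : ℝ) ≠ 0 := by exact_mod_cast Nat.factorial_ne_zero _
    have h1 : ((m + (n + 2)).factorial : ℝ) ≠ 0 := by exact_mod_cast Nat.factorial_ne_zero _
    have h2 : (m : ℝ) + 1 ≠ 0 := by positivity
    rw [show m + 1 + (n + 1) = m + (n + 2) by ring, Nat.factorial_succ]
    push_cast
    field_simp
    ring
  have h3 := h2.add ((summable_besselE (n + 1) t).hasSum.mul_left ((n : ℝ) + 1))
  refine h3.unique ((summable_besselE n t).hasSum.congr_fun fun m => ?_)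
  have h0 : (m.factorial : ℝ) ≠ 0 := by exact_mod_cast Nat.factorial_ne_zero _
  have h1 : ((m + n).factorial : ℝ) ≠ 0 := by exact_mod_cast Nat.factorial_ne_zero _
  have h2 : (m : ℝ) + n + 1 ≠ 0 := by positivity
  rw [← add_assoc m n 1, Nat.factorial_succ]
  push_cast
  field_simp
  ring

/-- Every term after the first has `(m + 1 + n)! ≥ (n + 1)!` in its denominator. For fixed `t` and
large `n` the leading term `1/n!` thus dominates, whatever the sign of `t`. -/
theorem abs_besselE_sub_le (n : ℕ) (t : ℝ) :
    |besselE n t - 1 / (n.factorial : ℝ)| ≤ Real.exp |t| / ((n + 1).factorial : ℝ) := by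
  have hs := summable_besselE n t
  have e : besselE n t - 1 / (n.factorial : ℝ) = ∑' m : ℕ,
      t ^ (m + 1) / (((m + 1).factorial : ℝ) * ((m + 1 + n).factorial : ℝ)) := by
    rw [besselE, hs.tsum_eq_zero_add]
    simp
  have hexp : HasSum (fun m : ℕ => |t| ^ m / (m.factorial : ℝ)) (Real.exp |t|) := by
    rw [Real.exp_eq_exp_ℝ]
    exact NormedSpace.expSeries_div_hasSum_exp _
  have hexp' : Summable fun m : ℕ => |t| ^ (m + 1) / ((m + 1).factorial : ℝ) :=
    (summable_nat_add_iff 1).2 hexp.summable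
  have hle : ∑' m : ℕ, |t| ^ (m + 1) / ((m + 1).factorial : ℝ) ≤ Real.exp |t| := by
    rw [← hexp.tsum_eq, hexp.summable.tsum_eq_zero_add]
    simp
  rw [e, ← Real.norm_eq_abs]
  refine (tsum_of_norm_bounded (hexp'.hasSum.div_const ((n + 1).factorial : ℝ)) fun m => ?_).trans
    (by gcongr)
  have h1 : ((n + 1).factorial : ℝ) ≤ ((m + 1 + n).factorial : ℝ) := by
    exact_mod_cast Nat.factorial_le (by omega)
  rw [norm_div, norm_pow, Real.norm_eq_abs, Real.norm_eq_abs, div_div,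
    abs_of_pos (by positivity : (0 : ℝ) < ((m + 1).factorial : ℝ) * ((m + 1 + n).factorial : ℝ))]
  gcongr

theorem besselE_pos_of_exp_lt {n : ℕ} {t : ℝ} (h : Real.exp |t| < n + 1) : 0 < besselE n t := by
  have h1 := (abs_le.1 (abs_besselE_sub_le n t)).1
  have hn : (0 : ℝ) < n.factorial := by exact_mod_cast Nat.factorial_pos _
  have h2 : Real.exp |t| / ((n + 1).factorial : ℝ) < 1 / (n.factorial : ℝ) := by
    rw [Nat.factorial_succ]
    push_cast
    rw [div_lt_div_iff₀ (by positivity) hn]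
    nlinarith
  linarith

theorem besselE_pos_of_nonneg (n : ℕ) {t : ℝ} (h : 0 ≤ t) : 0 < besselE n t :=
  (summable_besselE n t).tsum_pos (fun m => by positivity) 0 (by simp; positivity)

theorem besselE_zero (n : ℕ) : besselE n 0 = 1 / (n.factorial : ℝ) := by
  rw [besselE, (summable_besselE n 0).tsum_eq_zero_add]
  simp

/-! ### Bessel functions as radial profiles. -/

theorem besselI_eq (n : ℕ) (x : ℝ) : besselI n x = (x / 2) ^ n * besselE n (x ^ 2 / 4) := by
  rw [besselI, besselE, ← tsum_mul_left]
  refine tsum_congr fun m => ?_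
  rw [pow_add, pow_mul, show (x / 2) ^ 2 = x ^ 2 / 4 by ring]
  ring

theorem besselJ_eq (n : ℕ) (x : ℝ) : besselJ n x = (x / 2) ^ n * besselE n (-x ^ 2 / 4) := by
  rw [besselJ, besselE, ← tsum_mul_left]
  refine tsum_congr fun m => ?_
  rw [pow_add, pow_mul, show -x ^ 2 / 4 = -1 * (x / 2) ^ 2 by ring, mul_pow (-1 : ℝ)]
  ring

/-- The radial solution `r^n E_n(μ r² / 4)` of the equation `r² ρ'' + r ρ' - n² ρ = μ r² ρ`. -/
noncomputable def profile (μ : ℝ) (n : ℕ) (r : ℝ) : ℝ := r ^ n * besselE n (μ * r ^ 2 / 4)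

theorem besselJ_mul_eq (n : ℕ) (α r : ℝ) :
    besselJ n (α * r) = (α / 2) ^ n * profile (-α ^ 2) n r := by
  rw [besselJ_eq, profile, ← mul_assoc, ← mul_pow]
  congr 2 <;> ring

theorem besselI_mul_eq (n : ℕ) (β r : ℝ) :
    besselI n (β * r) = (β / 2) ^ n * profile (β ^ 2) n r := by
  rw [besselI_eq, profile, ← mul_assoc, ← mul_pow]
  congr 2 <;> ring

/-- `r` times the derivative of `profile μ n`. -/
noncomputable def profileD (μ : ℝ) (n : ℕ) (r : ℝ) : ℝ :=
  n * profile μ n r + μ / 2 * r ^ (n + 2) * besselE (n + 1) (μ * r ^ 2 / 4)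

theorem hasDerivAt_besselE_sq (μ : ℝ) (n : ℕ) (r : ℝ) :
    HasDerivAt (fun r => besselE n (μ * r ^ 2 / 4))
      (μ / 2 * r * besselE (n + 1) (μ * r ^ 2 / 4)) r := by
  have h : HasDerivAt (fun r : ℝ => μ * r ^ 2 / 4) (μ / 2 * r) r := by
    convert! ((hasDerivAt_pow 2 r).const_mul μ).div_const 4 using 1
    norm_num
    ring
  convert! (hasDerivAt_besselE n _).comp r h using 1
  ring

theorem continuous_besselE (n : ℕ) : Continuous (besselE n) := (contDiff_besselE 0 n).continuous

theorem continuous_profile (μ : ℝ) (n : ℕ) : Continuous (profile μ n) := by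
  have := continuous_besselE n
  unfold profile
  fun_prop

theorem continuous_profileD (μ : ℝ) (n : ℕ) : Continuous (profileD μ n) := by
  have := continuous_profile μ n
  have := continuous_besselE (n + 1)
  unfold profileD
  fun_prop

theorem hasDerivAt_profile (μ : ℝ) (n : ℕ) {r : ℝ} (hr : r ≠ 0) :
    HasDerivAt (profile μ n) (profileD μ n r / r) r := by
  convert! (hasDerivAt_pow n r).mul (hasDerivAt_besselE_sq μ n r) using 1
  rw [profileD, profile]
  rcases n with _ | n
  · field_simp
    simp
    ring
  · simp only [Nat.add_sub_cancel]
    field_simp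
    ring

/-- With `hasDerivAt_profile` this writes the radial equation as the first-order system `rρ' = D`,
`rD' = (n² + μr²)ρ`, which the Fourier coefficients will also satisfy. -/
theorem hasDerivAt_profileD (μ : ℝ) (n : ℕ) {r : ℝ} (hr : r ≠ 0) :
    HasDerivAt (profileD μ n) ((n ^ 2 + μ * r ^ 2) * profile μ n r / r) r := by
  convert! ((hasDerivAt_profile μ n hr).const_mul (n : ℝ)).add
    (((hasDerivAt_pow (n + 2) r).const_mul (μ / 2)).mul (hasDerivAt_besselE_sq μ (n + 1) r)) using 1
  rw [profileD, profile, ← besselE_recurrence n (μ * r ^ 2 / 4)]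
  push_cast
  field_simp
  ring

theorem radial_eq (κ : ℝ) (k : ℤ) (α c d r : ℝ) :
    radial κ k α c d r = c * (α / 2) ^ k.natAbs * profile (-α ^ 2) k.natAbs r +
      d * (κ / α / 2) ^ k.natAbs * profile ((κ / α) ^ 2) k.natAbs r := by
  rw [radial, besselJ_mul_eq, besselI_mul_eq]
  ring

theorem besselJ_self (n : ℕ) (α : ℝ) : besselJ n α = (α / 2) ^ n * profile (-α ^ 2) n 1 := by
  simpa using besselJ_mul_eq n α 1

theorem besselI_self (n : ℕ) (β : ℝ) : besselI n β = (β / 2) ^ n * profile (β ^ 2) n 1 := by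
  simpa using besselI_mul_eq n β 1

theorem differentiable_besselJ (n : ℕ) : Differentiable ℝ (besselJ n) := by
  rw [show besselJ n = fun x => (x / 2) ^ n * besselE n (-x ^ 2 / 4) from funext (besselJ_eq n)]
  have := (contDiff_besselE 1 n).differentiable (by simp)
  fun_prop

theorem differentiable_besselI (n : ℕ) : Differentiable ℝ (besselI n) := by
  rw [show besselI n = fun x => (x / 2) ^ n * besselE n (x ^ 2 / 4) from funext (besselI_eq n)]
  have := (contDiff_besselE 1 n).differentiable (by simp)
  fun_prop

theorem mul_deriv_besselJ (n : ℕ) (α : ℝ) :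
    α * deriv (besselJ n) α = (α / 2) ^ n * profileD (-α ^ 2) n 1 := by
  have h1 : HasDerivAt (fun r => besselJ n (α * r)) (α * deriv (besselJ n) α) 1 := by
    have h := (differentiable_besselJ n (α * 1)).hasDerivAt.comp 1 (hasDerivAt_const_mul α)
    simpa [mul_comm] using! h
  have h2 := (hasDerivAt_profile (-α ^ 2) n one_ne_zero).const_mul ((α / 2) ^ n)
  rw [funext (besselJ_mul_eq n α)] at h1
  simpa using h1.unique h2

theorem mul_deriv_besselI (n : ℕ) (β : ℝ) :
    β * deriv (besselI n) β = (β / 2) ^ n * profileD (β ^ 2) n 1 := by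
  have h1 : HasDerivAt (fun r => besselI n (β * r)) (β * deriv (besselI n) β) 1 := by
    have h := (differentiable_besselI n (β * 1)).hasDerivAt.comp 1 (hasDerivAt_const_mul β)
    simpa [mul_comm] using! h
  have h2 := (hasDerivAt_profile (β ^ 2) n one_ne_zero).const_mul ((β / 2) ^ n)
  rw [funext (besselI_mul_eq n β)] at h1
  simpa using h1.unique h2

/-! ### The characteristic function as a determinant, and its finitely many orders. -/

theorem charF_eq (κ : ℝ) (k : ℤ) (α : ℝ) :
    charF κ k α = (α / 2) ^ k.natAbs * (κ / α / 2) ^ k.natAbs *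
      (profile (-α ^ 2) k.natAbs 1 * profileD ((κ / α) ^ 2) k.natAbs 1 -
        profile ((κ / α) ^ 2) k.natAbs 1 * profileD (-α ^ 2) k.natAbs 1) := by
  have e : charF κ k α = besselJ k.natAbs α * (κ / α * deriv (besselI k.natAbs) (κ / α)) -
      besselI k.natAbs (κ / α) * (α * deriv (besselJ k.natAbs) α) := by
    rw [charF]; ring
  rw [e, mul_deriv_besselI, mul_deriv_besselJ, besselJ_self, besselI_self]
  ring

theorem charF_eq_zero_iff {κ α : ℝ} (hκ : 0 < κ) (hα : 0 < α) (k : ℤ) :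
    charF κ k α = 0 ↔
      profile (-α ^ 2) k.natAbs 1 * profileD ((κ / α) ^ 2) k.natAbs 1 =
        profile ((κ / α) ^ 2) k.natAbs 1 * profileD (-α ^ 2) k.natAbs 1 := by
  have h : (α / 2) ^ k.natAbs * (κ / α / 2) ^ k.natAbs ≠ 0 := by positivity
  rw [charF_eq, mul_eq_zero, or_iff_right h, sub_eq_zero]

/-- In the determinant the terms with factor `|k|` cancel. What remains is `β²/2` and `α²/2` times
products of values of `E_|k|` and `E_(|k|+1)` at `-α²/4` and `β²/4`, where `β = κ/α`. For large
`|k|` all of these are positive. -/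
theorem finite_setOf_charF_eq_zero {κ α : ℝ} (hκ : 0 < κ) (hα : 0 < α) :
    {k : ℤ | charF κ k α = 0}.Finite := by
  obtain ⟨N, hN⟩ := exists_nat_gt (Real.exp |-α ^ 2 * 1 ^ 2 / 4|)
  refine (Set.finite_Icc (-(N : ℤ)) N).subset fun k hk => ?_
  by_contra hkN
  have hle : N ≤ k.natAbs := by
    by_contra h
    exact hkN ⟨by omega, by omega⟩
  have hle' : (N : ℝ) ≤ k.natAbs := by exact_mod_cast hle
  have h1 : 0 < besselE k.natAbs (-α ^ 2 * 1 ^ 2 / 4) := besselE_pos_of_exp_lt (by linarith)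
  have h2 : 0 < besselE (k.natAbs + 1) (-α ^ 2 * 1 ^ 2 / 4) :=
    besselE_pos_of_exp_lt (by push_cast; linarith)
  have h3 : 0 < besselE k.natAbs ((κ / α) ^ 2 * 1 ^ 2 / 4) := besselE_pos_of_nonneg _ (by positivity)
  have h4 : 0 < besselE (k.natAbs + 1) ((κ / α) ^ 2 * 1 ^ 2 / 4) :=
    besselE_pos_of_nonneg _ (by positivity)
  have h5 := (charF_eq_zero_iff hκ hα k).1 hk
  simp only [profileD, profile, one_pow, one_mul, mul_one] at h1 h2 h3 h4 h5
  have hβ : 0 < (κ / α) ^ 2 := by positivity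
  have hα2 : 0 < α ^ 2 := by positivity
  have h6 := mul_pos (mul_pos h1 h4) hβ
  have h7 := mul_pos (mul_pos h3 h2) hα2
  linarith

/-! ### The planar Laplacian of a power times a radial factor. -/

/-- The Laplacian is the trace of the second derivative, and `e`, `ie` are orthogonal of equal
length. Taking `e = z` gives the radial and angular frame without normalizing it. -/
theorem norm_sq_mul_laplacian (f : ℂ → ℂ) (z e : ℂ) :
    (‖e‖ : ℂ) ^ 2 * Δ f z = fderiv ℝ (fderiv ℝ f) z e e +
      fderiv ℝ (fderiv ℝ f) z (Complex.I * e) (Complex.I * e) := by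
  have h1 : e = e.re • (1 : ℂ) + e.im • Complex.I := by
    apply Complex.ext <;> simp
  have h2 : Complex.I * e = (-e.im) • (1 : ℂ) + e.re • Complex.I := by
    apply Complex.ext <;> simp
  have h3 : (‖e‖ : ℂ) ^ 2 = (e.re : ℂ) ^ 2 + (e.im : ℂ) ^ 2 := by
    have : ‖e‖ ^ 2 = e.re ^ 2 + e.im ^ 2 := by rw [Complex.sq_norm, Complex.normSq_apply]; ring
    exact_mod_cast this
  rw [laplacian_eq_iteratedFDeriv_complexPlane]
  beta_reduce
  rw [iteratedFDeriv_two_apply, iteratedFDeriv_two_apply, h3]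
  generalize fderiv ℝ (fderiv ℝ f) z = B
  rw [h2]
  nth_rw 3 4 [h1]
  simp only [map_add, map_smul, add_apply, smul_apply]
  simp only [Complex.real_smul]
  simp
  ring

theorem fderiv_fderiv_apply_of_hasLineDerivAt {f g : ℂ → ℂ} {z v d : ℂ} (hf : ContDiff ℝ 2 f)
    (hg : ∀ w, HasLineDerivAt ℝ f (g w) w v) (hd : HasLineDerivAt ℝ g d z v) :
    fderiv ℝ (fderiv ℝ f) z v v = d := by
  have e : g = fun w => fderiv ℝ f w v := funext fun w =>
    (hg w).unique ((hf.differentiable (by simp) w).hasFDerivAt.hasLineDerivAt v)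
  have hf' : Differentiable ℝ (fderiv ℝ f) :=
    (hf.fderiv_right (m := 1) (by norm_num)).differentiable (by simp)
  rw [e] at hd
  exact ((((hf' z).hasFDerivAt.clm_apply (hasFDerivAt_const v z)).hasLineDerivAt v).unique hd).symm ▸
    by simp

theorem hasLineDerivAt_norm_sq (w v : ℂ) :
    HasLineDerivAt ℝ (fun w : ℂ => ‖w‖ ^ 2) (2 * inner ℝ w v) w v := by
  simpa [mul_add] using! (hasStrictFDerivAt_norm_sq w).hasFDerivAt.hasLineDerivAt v

theorem hasLineDerivAt_comp_mul_radial (L : ℂ →L[ℝ] ℂ) {P P' : ℂ → ℂ} {h h' : ℝ → ℝ}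
    (hP : ∀ w, HasDerivAt P (P' w) w) (hh : ∀ t, HasDerivAt h (h' t) t) (w v : ℂ) :
    HasLineDerivAt ℝ (fun z => P (L z) * (h (‖z‖ ^ 2) : ℂ))
      (P' (L w) * L v * (h (‖w‖ ^ 2) : ℂ) +
        P (L w) * ((h' (‖w‖ ^ 2) * (2 * inner ℝ w v) : ℝ) : ℂ)) w v := by
  have h1 : HasDerivAt (fun t : ℝ => L (w + t • v)) (L v) 0 :=
    L.hasFDerivAt.hasLineDerivAt (x := w) v
  have h2 : HasDerivAt (fun t : ℝ => P (L (w + t • v))) (P' (L w) * L v) 0 := by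
    have := (hP (L (w + (0 : ℝ) • v))).comp (0 : ℝ) h1
    simpa using! this
  have h3 : HasDerivAt (fun t : ℝ => h (‖w + t • v‖ ^ 2))
      (h' (‖w‖ ^ 2) * (2 * inner ℝ w v)) 0 := by
    have := (hh (‖w + (0 : ℝ) • v‖ ^ 2)).comp (0 : ℝ) (hasLineDerivAt_norm_sq w v)
    simpa using! this
  have := h2.mul h3.ofReal_comp
  simpa [HasLineDerivAt] using! this

theorem hasLineDerivAt_inner_right (w v : ℂ) :
    HasLineDerivAt ℝ (fun w : ℂ => ((2 * inner ℝ w v : ℝ) : ℂ)) ((2 * inner ℝ v v : ℝ) : ℂ) w v := by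
  have h : HasDerivAt (fun t : ℝ => 2 * inner ℝ (w + t • v) v) (2 * inner ℝ v v) (0 : ℝ) := by
    simp only [inner_add_left, real_inner_smul_left]
    simpa using ((hasDerivAt_mul_const (inner ℝ v v)).const_add (inner ℝ w v)).const_mul (2 : ℝ)
  exact h.ofReal_comp

/-- `L` covers the identity and conjugation at once. The power `L z ^ n` is harmonic because `(L 1)²
+ (L I)² = 0`; the cross term contributes `4n h'` by Euler's identity; the radial factor contributes
`4h' + 4|z|²h''`. -/
theorem laplacian_pow_mul_radial (L : ℂ →L[ℝ] ℂ) (hL1 : L 1 = 1) (hLI : L Complex.I ^ 2 = -1)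
    (n : ℕ) {h h' h'' : ℝ → ℝ} (hc : ContDiff ℝ 2 h) (hh : ∀ t, HasDerivAt h (h' t) t)
    (hh' : ∀ t, HasDerivAt h' (h'' t) t) (z : ℂ) :
    Δ (fun z => L z ^ n * (h (‖z‖ ^ 2) : ℂ)) z =
      L z ^ n * ((4 * (n + 1) * h' (‖z‖ ^ 2) + 4 * ‖z‖ ^ 2 * h'' (‖z‖ ^ 2) : ℝ) : ℂ) := by
  set f : ℂ → ℂ := fun z => L z ^ n * (h (‖z‖ ^ 2) : ℂ)
  have hf : ContDiff ℝ 2 f :=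
    (L.contDiff.pow n).mul (Complex.ofRealCLM.contDiff.comp (hc.comp (contDiff_norm_sq ℝ)))
  set P1 : ℂ → ℂ := fun w => n * w ^ (n - 1)
  set P2 : ℂ → ℂ := fun w => n * ((n - 1 : ℕ) * w ^ (n - 1 - 1))
  have hP : ∀ w : ℂ, HasDerivAt (fun w => w ^ n) (P1 w) w := fun w => hasDerivAt_pow n w
  have hP1 : ∀ w : ℂ, HasDerivAt P1 (P2 w) w := fun w => (hasDerivAt_pow (n - 1) w).const_mul _
  have key : ∀ v, fderiv ℝ (fderiv ℝ f) z v v =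
      (P2 (L z) * L v * (h (‖z‖ ^ 2) : ℂ) + P1 (L z) * ((h' (‖z‖ ^ 2) * (2 * inner ℝ z v) : ℝ) : ℂ))
        * L v +
      ((P1 (L z) * L v * (h' (‖z‖ ^ 2) : ℂ) +
        L z ^ n * ((h'' (‖z‖ ^ 2) * (2 * inner ℝ z v) : ℝ) : ℂ)) * ((2 * inner ℝ z v : ℝ) : ℂ) +
        L z ^ n * (h' (‖z‖ ^ 2) : ℂ) * ((2 * inner ℝ v v : ℝ) : ℂ)) := by
    intro v
    refine fderiv_fderiv_apply_of_hasLineDerivAt hf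
      (g := fun w => (P1 (L w) * (h (‖w‖ ^ 2) : ℂ)) * L v +
        (L w ^ n * (h' (‖w‖ ^ 2) : ℂ)) * ((2 * inner ℝ w v : ℝ) : ℂ)) (fun w => ?_) ?_
    · convert! hasLineDerivAt_comp_mul_radial L hP hh w v using 1
      push_cast
      ring
    · have h1 : HasDerivAt _ _ _ := hasLineDerivAt_comp_mul_radial L hP1 hh z v
      have h2 : HasDerivAt _ _ _ := hasLineDerivAt_comp_mul_radial L hP hh' z v
      have h3 : HasDerivAt _ _ _ := hasLineDerivAt_inner_right z v
      have := (h1.mul_const (L v)).add (h2.mul h3)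
      simpa [HasLineDerivAt] using! this
  -- Euler's identity for `w ^ n`. The truncated exponent `n - 1` is harmless at `n = 0`, where the
  -- factor `n` vanishes.
  have hP1w : ∀ w, P1 w * w = n * w ^ n := by
    intro w
    rcases n with _ | n
    · simp [P1]
    · simp only [P1, Nat.add_sub_cancel]
      ring
  have hLz : L z = z.re + z.im * L Complex.I := by
    have : z = z.re • (1 : ℂ) + z.im • Complex.I := by apply Complex.ext <;> simp
    calc L z = L (z.re • (1 : ℂ) + z.im • Complex.I) := congrArg L this
      _ = _ := by rw [map_add, map_smul, map_smul, hL1]; simp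
  have hq : (‖z‖ : ℂ) ^ 2 = z.re ^ 2 + z.im ^ 2 := by
    have : ‖z‖ ^ 2 = z.re ^ 2 + z.im ^ 2 := by rw [Complex.sq_norm, Complex.normSq_apply]; ring
    exact_mod_cast this
  have hi1 : inner ℝ z (1 : ℂ) = z.re := by simp [Complex.inner]
  have hiI : inner ℝ z Complex.I = z.im := by simp [Complex.inner]
  have hlap := norm_sq_mul_laplacian f z 1
  rw [norm_one, Complex.ofReal_one, one_pow, one_mul, mul_one] at hlap
  rw [hlap, key, key, hi1, hiI, hL1]
  have h11 : inner ℝ (1 : ℂ) (1 : ℂ) = (1 : ℝ) := by simp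
  have hII : inner ℝ Complex.I Complex.I = (1 : ℝ) := by simp
  rw [h11, hII]
  have hPz := hP1w (L z)
  push_cast
  rw [hq]
  generalize P1 (L z) = p1 at *
  generalize P2 (L z) = p2 at *
  generalize hp0 : L z ^ n = p0 at *
  rw [hLz] at hPz
  linear_combination (4 * (h' (‖z‖ ^ 2) : ℂ)) * hPz + p2 * (h (‖z‖ ^ 2) : ℂ) * hLI

/-! ### Smooth eigenfunctions of the Laplacian with angular dependence `e^{ikθ}`. -/

/-- `r^|k| e^{ikθ}` as a function of `z = r e^{iθ}`: the power `z^k`, or `(conj z)^|k|` for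
negative `k`. -/
noncomputable def angularMonomial (k : ℤ) (z : ℂ) : ℂ :=
  (if 0 ≤ k then ContinuousLinearMap.id ℝ ℂ else (Complex.conjCLE : ℂ →L[ℝ] ℂ)) z ^ k.natAbs

theorem angularMonomial_polar (k : ℤ) (r θ : ℝ) :
    angularMonomial k (r * Complex.exp (Complex.I * θ)) =
      (r : ℂ) ^ k.natAbs * Complex.exp (Complex.I * k * θ) := by
  unfold angularMonomial
  split_ifs with hk
  · rw [ContinuousLinearMap.id_apply, mul_pow, ← Complex.exp_nat_mul]
    have : ((k.natAbs : ℕ) : ℂ) = (k : ℂ) := by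
      rw [← Int.cast_natCast, Int.natAbs_of_nonneg hk]
    rw [this]
    ring_nf
  · have : ((k.natAbs : ℕ) : ℂ) = -(k : ℂ) := by
      rw [← Int.cast_natCast, Int.ofNat_natAbs_of_nonpos (by omega)]
      simp
    simp only [ContinuousLinearEquiv.coe_coe, Complex.conjCLE_apply, map_mul, Complex.conj_ofReal,
      mul_pow, ← Complex.exp_conj, Complex.conj_I]
    rw [← Complex.exp_nat_mul, this]
    ring_nf

/-- The solution `ρ(r) e^{ikθ}` of `Δ f = μ f`, where `ρ = profile μ |k|`. -/
noncomputable def helmholtzMode (μ : ℝ) (k : ℤ) (z : ℂ) : ℂ :=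
  angularMonomial k z * (besselE k.natAbs (μ * ‖z‖ ^ 2 / 4) : ℂ)

theorem helmholtzMode_polar (μ : ℝ) (k : ℤ) (r θ : ℝ) :
    helmholtzMode μ k (r * Complex.exp (Complex.I * θ)) =
      profile μ k.natAbs r * Complex.exp (Complex.I * k * θ) := by
  have : ‖(r : ℂ) * Complex.exp (Complex.I * θ)‖ ^ 2 = r ^ 2 := by
    rw [mul_comm Complex.I, norm_mul, Complex.norm_exp_ofReal_mul_I]
    simp
  rw [helmholtzMode, angularMonomial_polar, profile, this]
  push_cast
  ring

theorem contDiff_helmholtzMode (μ : ℝ) (k : ℤ) (j : ℕ) : ContDiff ℝ j (helmholtzMode μ k) := by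
  have h1 : ContDiff ℝ j fun z : ℂ => μ * ‖z‖ ^ 2 / 4 :=
    (contDiff_const.mul (contDiff_norm_sq ℝ)).div_const 4
  exact ((ContinuousLinearMap.contDiff _).pow _).mul
    (Complex.ofRealCLM.contDiff.comp ((contDiff_besselE j k.natAbs).comp h1))

/-- For `h(t) = E_n(μt/4)` the expression `4(n + 1)h' + 4t h''` equals `μ` times the left side of
`besselE_recurrence` at `μt/4`. -/
theorem laplacian_helmholtzMode (μ : ℝ) (k : ℤ) (z : ℂ) :
    Δ (helmholtzMode μ k) z = μ * helmholtzMode μ k z := by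
  have hlin : ∀ t, HasDerivAt (fun t : ℝ => μ * t / 4) (μ / 4) t := fun t => by
    simpa using ((hasDerivAt_id t).const_mul μ).div_const 4
  have hd : ∀ m t, HasDerivAt (fun t : ℝ => besselE m (μ * t / 4))
      (besselE (m + 1) (μ * t / 4) * (μ / 4)) t := fun m t =>
    (hasDerivAt_besselE m (μ * t / 4)).comp (h := fun t : ℝ => μ * t / 4) t (hlin t)
  have hc : ContDiff ℝ 2 fun t : ℝ => besselE k.natAbs (μ * t / 4) := by
    exact_mod_cast (contDiff_besselE 2 k.natAbs).comp (by fun_prop)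
  have := laplacian_pow_mul_radial
    (if 0 ≤ k then ContinuousLinearMap.id ℝ ℂ else (Complex.conjCLE : ℂ →L[ℝ] ℂ))
    (by split_ifs <;> simp) (by split_ifs <;> simp) k.natAbs hc (hd _)
    (fun t => (hd (k.natAbs + 1) t).mul_const (μ / 4)) z
  refine Eq.trans this ?_
  rw [helmholtzMode, angularMonomial, ← besselE_recurrence k.natAbs]
  push_cast
  ring

open Complex (exp I)
open scoped Real Topology
open Filter

/-! ### Fourier coefficients on circles and their radial equation. -/

theorem hasDerivAt_intervalIntegral_of_continuousOn {F F' : ℝ → ℝ → ℂ} {s : Set ℝ} (hs : IsOpen s)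
    (hF : ContinuousOn (Function.uncurry F) (s ×ˢ Set.univ))
    (hF' : ContinuousOn (Function.uncurry F') (s ×ˢ Set.univ))
    (hd : ∀ r ∈ s, ∀ θ, HasDerivAt (fun r => F r θ) (F' r θ) r) (a b : ℝ) {r : ℝ} (hr : r ∈ s) :
    HasDerivAt (fun r => ∫ θ in a..b, F r θ) (∫ θ in a..b, F' r θ) r := by
  obtain ⟨K, hK, hrK, hKs⟩ := exists_compact_subset hs hr
  have hcont : ∀ G : ℝ → ℝ → ℂ, ContinuousOn (Function.uncurry G) (s ×ˢ Set.univ) →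
      ∀ x ∈ s, Continuous (G x) := fun G hG x hx => by
    rw [← continuousOn_univ]
    exact hG.comp (Continuous.continuousOn (by fun_prop : Continuous fun θ : ℝ => (x, θ)))
      fun θ _ => ⟨hx, trivial⟩
  obtain ⟨C, hC⟩ := (hK.prod (isCompact_uIcc (a := a) (b := b))).exists_bound_of_continuousOn
    (hF'.mono (Set.prod_mono hKs (Set.subset_univ _)))
  refine (intervalIntegral.hasDerivAt_integral_of_dominated_loc_of_deriv_le
    (bound := fun _ => C) (isOpen_interior.mem_nhds hrK) ?_ ?_ ?_ ?_ ?_ ?_).2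
  · filter_upwards [hs.mem_nhds hr] with x hx
    exact (hcont F hF x hx).aestronglyMeasurable
  · exact (hcont F hF r hr).intervalIntegrable _ _
  · exact (hcont F' hF' r hr).aestronglyMeasurable
  · refine .of_forall fun θ hθ x hx => hC (x, θ) ⟨interior_subset hx, Set.uIoc_subset_uIcc hθ⟩
  · exact intervalIntegrable_const
  · exact .of_forall fun θ _ x hx => hd x (hKs (interior_subset hx)) θ

theorem continuous_polar : Continuous fun p : ℝ × ℝ => (p.1 : ℂ) * exp (I * p.2) := by fun_prop

theorem norm_polar (r θ : ℝ) : ‖(r : ℂ) * exp (I * θ)‖ = |r| := by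
  rw [mul_comm I, norm_mul, Complex.norm_exp_ofReal_mul_I]
  simp

/-- The `k`-th Fourier coefficient (times `2π`) of `f` on the circle of radius `r`. -/
noncomputable def circleCoeff (f : ℂ → ℂ) (k : ℤ) (r : ℝ) : ℂ :=
  ∫ θ in (0 : ℝ)..2 * π, f (r * exp (I * θ)) * exp (-(I * k * θ))

/-- The `k`-th Fourier coefficient (times `2π`) of `r ∂ᵣ f` on the circle of radius `r`. -/
noncomputable def circleCoeffD (f : ℂ → ℂ) (k : ℤ) (r : ℝ) : ℂ :=
  ∫ θ in (0 : ℝ)..2 * π,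
    fderiv ℝ f (r * exp (I * θ)) (r * exp (I * θ)) * exp (-(I * k * θ))

theorem polar_mem_ball {r : ℝ} (hr : r ∈ Set.Ioo (-1 : ℝ) 1) (θ : ℝ) :
    (r : ℂ) * exp (I * θ) ∈ ball (0 : ℂ) 1 := by
  rw [mem_ball_zero_iff, norm_polar]
  exact abs_lt.2 hr

theorem hasDerivAt_polar_left (r θ : ℝ) :
    HasDerivAt (fun r : ℝ => (r : ℂ) * exp (I * θ)) (exp (I * θ)) r := by
  simpa using (Complex.ofRealCLM.hasDerivAt (x := r)).mul_const (exp (I * θ))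

theorem hasDerivAt_polar_right (r θ : ℝ) :
    HasDerivAt (fun θ : ℝ => (r : ℂ) * exp (I * θ)) (I * (r * exp (I * θ))) θ := by
  have h : HasDerivAt (fun θ : ℝ => I * (θ : ℂ)) I θ := by
    simpa using (Complex.ofRealCLM.hasDerivAt (x := θ)).const_mul I
  convert! h.cexp.const_mul (r : ℂ) using 1
  ring

theorem hasDerivAt_clm_apply_curve {A : ℂ → ℂ →L[ℝ] ℂ} {A' : ℂ →L[ℝ] ℂ →L[ℝ] ℂ} {γ δ : ℝ → ℂ}
    {γ' δ' : ℂ} {t : ℝ} (hA : HasFDerivAt A A' (γ t)) (hγ : HasDerivAt γ γ' t)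
    (hδ : HasDerivAt δ δ' t) :
    HasDerivAt (fun t => A (γ t) (δ t)) (A' γ' (δ t) + A (γ t) δ') t := by
  have h1 : HasDerivAt (fun t => A (γ t)) (A' γ') t := hA.comp_hasDerivAt t hγ
  exact HasDerivAt.clm_apply h1 hδ

theorem continuousOn_comp_polar {E : Type*} [TopologicalSpace E] {g : ℂ → E}
    (hg : ContinuousOn g (ball 0 1)) :
    ContinuousOn (fun p : ℝ × ℝ => g (p.1 * exp (I * p.2))) (Set.Ioo (-1 : ℝ) 1 ×ˢ Set.univ) :=
  hg.comp continuous_polar.continuousOn fun p hp => polar_mem_ball hp.1 p.2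

section

variable {f : ℂ → ℂ}

/-- Negative radii are allowed so that `r = 0` is an interior point; continuity of the coefficient
at the centre is then immediate. -/
theorem hasDerivAt_circleCoeff (hf : ContDiffOn ℝ 1 f (ball 0 1)) (k : ℤ) {r : ℝ}
    (hr : r ∈ Set.Ioo (-1 : ℝ) 1) :
    HasDerivAt (circleCoeff f k) (∫ θ in (0 : ℝ)..2 * π,
      fderiv ℝ f (r * exp (I * θ)) (exp (I * θ)) * exp (-(I * k * θ))) r := by
  have hf' := hf.continuousOn_fderiv_of_isOpen isOpen_ball le_rfl
  refine hasDerivAt_intervalIntegral_of_continuousOn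
    (F := fun r θ => f (r * exp (I * θ)) * exp (-(I * k * θ)))
    (F' := fun r θ => fderiv ℝ f (r * exp (I * θ)) (exp (I * θ)) * exp (-(I * k * θ)))
    isOpen_Ioo ?_ ?_ ?_ _ _ hr
  · exact (continuousOn_comp_polar hf.continuousOn).mul (Continuous.continuousOn (by fun_prop))
  · exact ((continuousOn_comp_polar hf').clm_apply (Continuous.continuousOn (by fun_prop))).mul
      (Continuous.continuousOn (by fun_prop))
  · intro r hr θ
    have hd : HasFDerivAt f (fderiv ℝ f (r * exp (I * θ))) (r * exp (I * θ)) :=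
      ((hf.differentiableOn (by simp)).differentiableAt
        (isOpen_ball.mem_nhds (polar_mem_ball hr θ))).hasFDerivAt
    exact (hd.comp_hasDerivAt r (hasDerivAt_polar_left r θ)).mul_const _

theorem hasDerivAt_circleCoeffD_of_hasFDerivAt {A : ℂ → ℂ →L[ℝ] ℂ} {B : ℂ → ℂ →L[ℝ] ℂ →L[ℝ] ℂ}
    (hA : ∀ z ∈ ball (0 : ℂ) 1, HasFDerivAt A (B z) z) (hB : ContinuousOn B (ball 0 1)) (k : ℤ)
    {r : ℝ} (hr : r ∈ Set.Ioo (-1 : ℝ) 1) :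
    HasDerivAt (fun r : ℝ => ∫ θ in (0 : ℝ)..2 * π,
        A (r * exp (I * θ)) (r * exp (I * θ)) * exp (-(I * k * θ)))
      (∫ θ in (0 : ℝ)..2 * π, (B (r * exp (I * θ)) (exp (I * θ)) (r * exp (I * θ)) +
        A (r * exp (I * θ)) (exp (I * θ))) * exp (-(I * k * θ))) r := by
  have hc : ContinuousOn (fun p : ℝ × ℝ => exp (I * p.2)) (Set.Ioo (-1 : ℝ) 1 ×ˢ Set.univ) :=
    Continuous.continuousOn (by fun_prop)
  have hk : ContinuousOn (fun p : ℝ × ℝ => exp (-(I * k * p.2)))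
    (Set.Ioo (-1 : ℝ) 1 ×ˢ Set.univ) := Continuous.continuousOn (by fun_prop)
  have hAc := continuousOn_comp_polar fun z hz => (hA z hz).continuousAt.continuousWithinAt
  have hz : ContinuousOn (fun p : ℝ × ℝ => (p.1 : ℂ) * exp (I * p.2))
    (Set.Ioo (-1 : ℝ) 1 ×ˢ Set.univ) := continuous_polar.continuousOn
  refine hasDerivAt_intervalIntegral_of_continuousOn
    (F := fun r θ => A (r * exp (I * θ)) (r * exp (I * θ)) * exp (-(I * k * θ)))
    (F' := fun r θ => (B (r * exp (I * θ)) (exp (I * θ)) (r * exp (I * θ)) +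
        A (r * exp (I * θ)) (exp (I * θ))) * exp (-(I * k * θ)))
    isOpen_Ioo ?_ ?_ ?_ _ _ hr
  · exact (hAc.clm_apply hz).mul hk
  · exact ((((continuousOn_comp_polar hB).clm_apply hc).clm_apply hz).add (hAc.clm_apply hc)).mul hk
  · intro r hr θ
    have h := hasDerivAt_clm_apply_curve (γ := fun r => r * exp (I * θ))
      (hA _ (polar_mem_ball hr θ)) (hasDerivAt_polar_left r θ)
      (hasDerivAt_polar_left r θ)
    exact HasDerivAt.mul_const h _

theorem hasFDerivAt_fderiv_of_contDiffOn (hf : ContDiffOn ℝ 2 f (ball 0 1)) :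
    ∀ z ∈ ball (0 : ℂ) 1, HasFDerivAt (fderiv ℝ f) (fderiv ℝ (fderiv ℝ f) z) z := fun z hz =>
  (((hf.fderiv_of_isOpen (m := 1) isOpen_ball (by norm_num)).differentiableOn
    (by simp)).differentiableAt (isOpen_ball.mem_nhds hz)).hasFDerivAt

theorem continuousOn_fderiv_fderiv (hf : ContDiffOn ℝ 2 f (ball 0 1)) :
    ContinuousOn (fderiv ℝ (fderiv ℝ f)) (ball 0 1) :=
  (hf.fderiv_of_isOpen (m := 1) isOpen_ball (by norm_num)).continuousOn_fderiv_of_isOpen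
    isOpen_ball le_rfl

theorem continuousOn_circleCoeffD (hf : ContDiffOn ℝ 2 f (ball 0 1)) (k : ℤ) :
    ContinuousOn (circleCoeffD f k) (Set.Ioo (-1) 1) := fun _ hr =>
  (hasDerivAt_circleCoeffD_of_hasFDerivAt (hasFDerivAt_fderiv_of_contDiffOn hf)
    (continuousOn_fderiv_fderiv hf) k hr).continuousAt.continuousWithinAt

theorem hasDerivAt_circleCoeff' (hf : ContDiffOn ℝ 1 f (ball 0 1)) (k : ℤ) {r : ℝ}
    (hr : r ∈ Set.Ioo (0 : ℝ) 1) :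
    HasDerivAt (circleCoeff f k) (circleCoeffD f k r / r) r := by
  convert! hasDerivAt_circleCoeff hf k (Set.Ioo_subset_Ioo_left (by simp) hr) using 1
  rw [circleCoeffD, ← intervalIntegral.integral_div]
  congr 1 with θ
  have hr0 : (r : ℂ) ≠ 0 := by exact_mod_cast hr.1.ne'
  rw [← Complex.real_smul, map_smul, Complex.real_smul]
  field_simp

theorem integral_second_deriv_mul_exp {g g' g'' : ℝ → ℂ} (h0 : ∀ θ, HasDerivAt g (g' θ) θ)
    (h1 : ∀ θ, HasDerivAt g' (g'' θ) θ) (hc : Continuous g'') (hg : g (2 * π) = g 0)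
    (hg' : g' (2 * π) = g' 0) (k : ℤ) :
    ∫ θ in (0 : ℝ)..2 * π, g'' θ * exp (-(I * k * θ)) =
      -(k : ℂ) ^ 2 * ∫ θ in (0 : ℝ)..2 * π, g θ * exp (-(I * k * θ)) := by
  have hgc : Continuous g := continuous_iff_continuousAt.2 fun θ => (h0 θ).continuousAt
  have hE : ∀ θ : ℝ, HasDerivAt (fun θ : ℝ => exp (-(I * k * θ)))
      (exp (-(I * k * θ)) * -(I * k)) θ := fun θ => by
    have h : HasDerivAt (fun θ : ℝ => -(I * k * (θ : ℂ))) (-(I * k)) θ := by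
      simpa [neg_mul] using ((Complex.ofRealCLM.hasDerivAt (x := θ)).const_mul (-(I * k)))
    exact h.cexp
  -- Both integrations by parts at once: `(g' + ikg)e^{-ikθ}` has derivative `(g'' + k²g)e^{-ikθ}`,
  -- and it is periodic.
  have key := intervalIntegral.integral_eq_sub_of_hasDerivAt
    (f := fun θ : ℝ => (g' θ + I * k * g θ) * exp (-(I * k * θ)))
    (f' := fun θ : ℝ => g'' θ * exp (-(I * k * θ)) + (k : ℂ) ^ 2 * (g θ * exp (-(I * k * θ))))
    (a := 0) (b := 2 * π) (fun θ _ => by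
      convert! ((h1 θ).add ((h0 θ).const_mul (I * k))).mul (hE θ) using 1
      rw [Pi.add_apply]
      linear_combination ((k : ℂ) ^ 2 * g θ * exp (-(I * k * θ))) * Complex.I_sq)
    (Continuous.intervalIntegrable (by fun_prop) _ _)
  have hper : exp (-(I * k * (2 * π : ℝ))) = 1 := by
    rw [Complex.exp_eq_one_iff]
    exact ⟨-k, by push_cast; ring⟩
  rw [intervalIntegral.integral_add (Continuous.intervalIntegrable (by fun_prop) _ _)
    (Continuous.intervalIntegrable (by fun_prop) _ _), intervalIntegral.integral_const_mul, hg, hg',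
    hper] at key
  simp only [Complex.ofReal_zero, mul_zero, neg_zero, Complex.exp_zero, sub_self] at key
  linear_combination key

/-- The polar form `r ∂ᵣ(r ∂ᵣf) + ∂θ²f = r²Δf = μr²f`, integrated against `e^{-ikθ}`; the angular
term yields `-k²`. Here `A` and `B` play the first and second derivatives of `f`. -/
theorem integral_second_radial_deriv {μ : ℝ} {A : ℂ → ℂ →L[ℝ] ℂ} {B : ℂ → ℂ →L[ℝ] ℂ →L[ℝ] ℂ}
    (hf : ∀ z ∈ ball (0 : ℂ) 1, HasFDerivAt f (A z) z)
    (hA : ∀ z ∈ ball (0 : ℂ) 1, HasFDerivAt A (B z) z) (hB : ContinuousOn B (ball 0 1))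
    (hμ : ∀ z ∈ ball (0 : ℂ) 1, ∀ e, (‖e‖ : ℂ) ^ 2 * (μ * f z) = B z e e + B z (I * e) (I * e))
    (k : ℤ) {r : ℝ} (hr : r ∈ Set.Ioo (0 : ℝ) 1) :
    ∫ θ in (0 : ℝ)..2 * π, (B (r * exp (I * θ)) (exp (I * θ)) (r * exp (I * θ)) +
        A (r * exp (I * θ)) (exp (I * θ))) * exp (-(I * k * θ)) =
      ((k : ℂ) ^ 2 + μ * r ^ 2) * circleCoeff f k r / r := by
  have hr' : r ∈ Set.Ioo (-1 : ℝ) 1 := Set.Ioo_subset_Ioo_left (by simp) hr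
  have hr0 : (r : ℂ) ≠ 0 := by exact_mod_cast hr.1.ne'
  have hz : Continuous fun θ : ℝ => (r : ℂ) * exp (I * θ) := by fun_prop
  have hIz : Continuous fun θ : ℝ => I * ((r : ℂ) * exp (I * θ)) := by fun_prop
  have hfc : Continuous fun θ : ℝ => f (r * exp (I * θ)) :=
    ContinuousOn.comp_continuous (fun z hz => (hf z hz).continuousAt.continuousWithinAt) hz
      (polar_mem_ball hr')
  have hAc : Continuous fun θ : ℝ => A (r * exp (I * θ)) :=
    ContinuousOn.comp_continuous (fun z hz => (hA z hz).continuousAt.continuousWithinAt) hz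
      (polar_mem_ball hr')
  have hBc : Continuous fun θ : ℝ => B (r * exp (I * θ)) :=
    hB.comp_continuous hz (polar_mem_ball hr')
  -- This function is `∂θ²f`: along the circle `z' = iz` and `z'' = -z`, whence the term `-A z z`.
  have hg'' : Continuous fun θ : ℝ => B (r * exp (I * θ)) (I * (r * exp (I * θ)))
      (I * (r * exp (I * θ))) - A (r * exp (I * θ)) (r * exp (I * θ)) :=
    ((hBc.clm_apply hIz).clm_apply hIz).sub (hAc.clm_apply hz)
  have hper : exp (I * (2 * π : ℝ)) = exp (I * (0 : ℝ)) := by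
    rw [mul_comm]
    simp
  have key := integral_second_deriv_mul_exp (g := fun θ => f (r * exp (I * θ)))
    (g' := fun θ => A (r * exp (I * θ)) (I * (r * exp (I * θ))))
    (g'' := fun θ => B (r * exp (I * θ)) (I * (r * exp (I * θ)))
        (I * (r * exp (I * θ))) - A (r * exp (I * θ)) (r * exp (I * θ)))
    (fun θ => (hf _ (polar_mem_ball hr' θ)).comp_hasDerivAt θ (hasDerivAt_polar_right r θ))
    (fun θ => by
      have h := hasDerivAt_clm_apply_curve (γ := fun θ => r * exp (I * θ))
        (hA _ (polar_mem_ball hr' θ))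
        (hasDerivAt_polar_right r θ) ((hasDerivAt_polar_right r θ).const_mul I)
      rwa [← mul_assoc I I, Complex.I_mul_I, neg_one_mul, map_neg, ← sub_eq_add_neg] at h)
    hg'' (by simp only [hper]) (by simp only [hper]) k
  have e : ∀ θ : ℝ, (B (r * exp (I * θ)) (exp (I * θ)) (r * exp (I * θ)) +
        A (r * exp (I * θ)) (exp (I * θ))) * exp (-(I * k * θ)) =
      μ * r * (f (r * exp (I * θ)) * exp (-(I * k * θ))) -
        (r : ℂ)⁻¹ * ((B (r * exp (I * θ)) (I * (r * exp (I * θ)))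
        (I * (r * exp (I * θ))) - A (r * exp (I * θ)) (r * exp (I * θ))) *
          exp (-(I * k * θ))) := by
    intro θ
    have hlap := hμ _ (polar_mem_ball hr' θ) (r * exp (I * θ))
    rw [norm_polar, abs_of_pos hr.1] at hlap
    generalize hw : (r : ℂ) * exp (I * θ) = w at *
    have hw' : w = r • exp (I * θ) := by rw [← hw, Complex.real_smul]
    have e1 : B w w w = r * B w (exp (I * θ)) w := by
      nth_rw 2 [hw']
      rw [map_smul, smul_apply, Complex.real_smul]
    have e2 : A w w = r * A w (exp (I * θ)) := by
      nth_rw 2 [hw']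
      rw [map_smul, Complex.real_smul]
    rw [e1] at hlap
    rw [e2]
    field_simp
    linear_combination -hlap
  simp only [e]
  rw [intervalIntegral.integral_sub, intervalIntegral.integral_const_mul,
    intervalIntegral.integral_const_mul, key, circleCoeff]
  · generalize (∫ θ in (0 : ℝ)..2 * π, f (r * exp (I * θ)) * exp (-(I * k * θ))) = c
    field_simp
    ring
  · exact (continuous_const.mul (hfc.mul (by fun_prop))).intervalIntegrable _ _
  · exact (continuous_const.mul (hg''.mul (by fun_prop))).intervalIntegrable _ _

theorem hasDerivAt_circleCoeffD {μ : ℝ} (hf : ContDiffOn ℝ 2 f (ball 0 1))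
    (hΔ : ∀ z ∈ ball (0 : ℂ) 1, Δ f z = μ * f z) (k : ℤ) {r : ℝ} (hr : r ∈ Set.Ioo (0 : ℝ) 1) :
    HasDerivAt (circleCoeffD f k) (((k : ℂ) ^ 2 + μ * r ^ 2) * circleCoeff f k r / r) r := by
  rw [← integral_second_radial_deriv (fun z hz => ((hf.differentiableOn (by simp)).differentiableAt
    (isOpen_ball.mem_nhds hz)).hasFDerivAt) (hasFDerivAt_fderiv_of_contDiffOn hf)
    (continuousOn_fderiv_fderiv hf) (fun z hz e => by
      rw [← hΔ z hz, norm_sq_mul_laplacian]) k hr]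
  exact hasDerivAt_circleCoeffD_of_hasFDerivAt (hasFDerivAt_fderiv_of_contDiffOn hf)
    (continuousOn_fderiv_fderiv hf) k (Set.Ioo_subset_Ioo_left (by simp) hr)

end

/-! ### Regular solutions of the radial system. -/

theorem eq_of_hasDerivAt_zero {W : ℝ → ℂ} (hc : ContinuousOn W (Set.Ioo (-1) 1))
    (hd : ∀ r ∈ Set.Ioo (0 : ℝ) 1, HasDerivAt W 0 r) {r : ℝ} (hr : r ∈ Set.Ioo (0 : ℝ) 1) :
    W r = W 0 := by
  have hconst : ∀ x ∈ Set.Ioo (0 : ℝ) 1, W x = W r := fun x hx => by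
    have := (convex_Ioo (0 : ℝ) 1).norm_image_sub_le_of_norm_hasDerivWithin_le (C := 0)
      (fun y hy => (hd y hy).hasDerivWithinAt) (fun y _ => by simp) hr hx
    simpa [sub_eq_zero] using this
  have h0 : Tendsto W (𝓝[>] 0) (𝓝 (W 0)) :=
    (hc.continuousAt (Ioo_mem_nhds (by norm_num) (by norm_num))).tendsto.mono_left
      nhdsWithin_le_nhds
  have h1 : Tendsto W (𝓝[>] 0) (𝓝 (W r)) := by
    refine tendsto_const_nhds.congr' ?_
    filter_upwards [Ioo_mem_nhdsGT (zero_lt_one (α := ℝ))] with x hx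
    exact (hconst x hx).symm
  exact tendsto_nhds_unique h1 h0

theorem exists_profile_ne_zero (μ : ℝ) (n : ℕ) : ∃ r ∈ Set.Ioo (0 : ℝ) 1, profile μ n r ≠ 0 := by
  have hc : Continuous fun r : ℝ => besselE n (μ * r ^ 2 / 4) := by
    have := continuous_besselE n
    fun_prop
  have h0 : besselE n (μ * 0 ^ 2 / 4) ≠ 0 := by
    have : (n.factorial : ℝ) ≠ 0 := by exact_mod_cast Nat.factorial_ne_zero n
    simp [besselE_zero, this]
  have h1 : ∀ᶠ r in 𝓝[>] (0 : ℝ), besselE n (μ * r ^ 2 / 4) ≠ 0 :=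
    nhdsWithin_le_nhds (hc.continuousAt.eventually_ne h0)
  obtain ⟨r, h, hr⟩ := (h1.and (Ioo_mem_nhdsGT (zero_lt_one (α := ℝ)))).exists
  exact ⟨r, hr, mul_ne_zero (pow_ne_zero _ hr.1.ne') h⟩

/-- Solutions on `(0, 1)` of the radial equation, as a first order system, vanish identically
once their Cauchy data vanish at one point. -/
theorem eq_zero_of_radial_system {μ : ℝ} {n : ℕ} {L P : ℝ → ℂ}
    (hL : ∀ r ∈ Set.Ioo (0 : ℝ) 1, HasDerivAt L (P r / r) r)
    (hP : ∀ r ∈ Set.Ioo (0 : ℝ) 1, HasDerivAt P (((n : ℂ) ^ 2 + μ * r ^ 2) * L r / r) r)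
    {r₀ : ℝ} (hr₀ : r₀ ∈ Set.Ioo (0 : ℝ) 1) (hL0 : L r₀ = 0) (hP0 : P r₀ = 0) {r : ℝ}
    (hr : r ∈ Set.Ioo (0 : ℝ) 1) : L r = 0 ∧ P r = 0 := by
  -- Staying to the right of `a > 0` avoids the singular point: on `(a, 1)` the system is Lipschitz
  -- with constant `(n² + |μ| + 1)/a`.
  obtain ⟨a, ha0, ha⟩ := exists_between (lt_min hr₀.1 hr.1)
  have har₀ : a < r₀ := ha.trans_le (min_le_left _ _)
  have har : a < r := ha.trans_le (min_le_right _ _)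
  have hsub : ∀ t ∈ Set.Ioo a 1, t ∈ Set.Ioo (0 : ℝ) 1 := fun t ht => ⟨ha0.trans ht.1, ht.2⟩
  set v : ℝ → ℂ × ℂ → ℂ × ℂ := fun t x => (x.2 / t, ((n : ℂ) ^ 2 + μ * t ^ 2) * x.1 / t)
  set K : NNReal := ((n : NNReal) ^ 2 + Real.nnabs μ + 1) / a.toNNReal
  have hK : (K : ℝ) = ((n : ℝ) ^ 2 + |μ| + 1) / a := by
    simp [K, Real.coe_toNNReal _ ha0.le]
  have hlip : ∀ t ∈ Set.Ioo a 1, LipschitzOnWith K (v t) Set.univ := by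
    intro t ht
    have ht0 : 0 < t := ha0.trans ht.1
    refine LipschitzOnWith.of_dist_le_mul fun x _ y _ => ?_
    rw [dist_eq_norm, dist_eq_norm, hK, div_mul_eq_mul_div, le_div_iff₀ ha0]
    have hn1 : ‖(n : ℂ) ^ 2 + μ * t ^ 2‖ ≤ (n : ℝ) ^ 2 + |μ| := by
      refine (norm_add_le _ _).trans ?_
      rw [norm_pow, norm_mul, norm_pow, Complex.norm_real, Complex.norm_real, Complex.norm_natCast,
        Real.norm_eq_abs, Real.norm_eq_abs, sq_abs]
      have : t ^ 2 ≤ 1 := by nlinarith [ht.2]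
      nlinarith [abs_nonneg μ]
    have hat : ∀ w : ℂ, ‖w / t‖ * a ≤ ‖w‖ := fun w => by
      rw [norm_div, Complex.norm_real, Real.norm_eq_abs, abs_of_pos ht0, div_mul_eq_mul_div,
        div_le_iff₀ ht0]
      exact mul_le_mul_of_nonneg_left ht.1.le (norm_nonneg _)
    have h1 : ‖(x - y).1‖ ≤ ‖x - y‖ := norm_fst_le _
    have h2 : ‖(x - y).2‖ ≤ ‖x - y‖ := norm_snd_le _
    have e : v t x - v t y = ((x - y).2 / t, ((n : ℂ) ^ 2 + μ * t ^ 2) * (x - y).1 / t) := by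
      ext <;> simp [v] <;> ring
    rw [e, Prod.norm_mk, max_mul_of_nonneg _ _ ha0.le]
    have hnn : 0 ≤ (n : ℝ) ^ 2 + |μ| := by positivity
    refine max_le ((hat _).trans ?_) ((hat _).trans ?_)
    · nlinarith [norm_nonneg (x - y)]
    · rw [norm_mul]
      have := mul_le_mul hn1 h1 (norm_nonneg _) hnn
      nlinarith [norm_nonneg (x - y)]
  have key := ODE_solution_unique_of_mem_Ioo (v := v) (s := fun _ => Set.univ) hlip ⟨har₀, hr₀.2⟩
    (f := fun t => (L t, P t)) (g := fun _ => (0, 0))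
    (fun t ht => ⟨(hL t (hsub t ht)).prodMk (hP t (hsub t ht)), trivial⟩)
    (fun t ht => ⟨by simpa [v] using! hasDerivAt_const t ((0, 0) : ℂ × ℂ), trivial⟩)
    (by simp [hL0, hP0]) ⟨har, hr.2⟩
  exact ⟨congrArg Prod.fst key, congrArg Prod.snd key⟩

/-- The Wronskian `L D - P ρ` with the regular solution is constant, and it is zero at `r = 0`
because `P` and `D` vanish there. So at a point where `ρ ≠ 0` the Cauchy data of `(L, P)` are
proportional to those of `(ρ, D)`, and ODE uniqueness spreads this over `(0, 1)`. -/
theorem exists_eq_mul_profile {μ : ℝ} {n : ℕ} {L P : ℝ → ℂ}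
    (hLc : ContinuousOn L (Set.Ioo (-1) 1)) (hPc : ContinuousOn P (Set.Ioo (-1) 1)) (hP0 : P 0 = 0)
    (hL : ∀ r ∈ Set.Ioo (0 : ℝ) 1, HasDerivAt L (P r / r) r)
    (hP : ∀ r ∈ Set.Ioo (0 : ℝ) 1, HasDerivAt P (((n : ℂ) ^ 2 + μ * r ^ 2) * L r / r) r) :
    ∃ A : ℂ, ∀ r ∈ Set.Ioo (0 : ℝ) 1, L r = A * profile μ n r ∧ P r = A * profileD μ n r := by
  have hρ : ∀ r ∈ Set.Ioo (0 : ℝ) 1,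
      HasDerivAt (fun r => (profile μ n r : ℂ)) (profileD μ n r / r) r := fun r hr => by
    exact_mod_cast (hasDerivAt_profile μ n hr.1.ne').ofReal_comp
  have hρD : ∀ r ∈ Set.Ioo (0 : ℝ) 1, HasDerivAt (fun r => (profileD μ n r : ℂ))
      (((n : ℂ) ^ 2 + μ * r ^ 2) * profile μ n r / r) r := fun r hr => by
    exact_mod_cast (hasDerivAt_profileD μ n hr.1.ne').ofReal_comp
  have hc := continuous_profile μ n
  have hcD := continuous_profileD μ n
  have hW : ∀ r ∈ Set.Ioo (0 : ℝ) 1, L r * profileD μ n r - P r * profile μ n r = 0 := by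
    intro r hr
    have := eq_of_hasDerivAt_zero (W := fun r => L r * profileD μ n r - P r * profile μ n r)
      ((hLc.mul (Continuous.continuousOn (by fun_prop))).sub
        (hPc.mul (Continuous.continuousOn (by fun_prop)))) (fun r hr => by
        convert! ((hL r hr).mul (hρD r hr)).sub ((hP r hr).mul (hρ r hr)) using 1
        ring) hr
    rw [this, hP0]
    rcases n with _ | n <;> simp [profileD, profile]
  obtain ⟨r₀, hr₀, hne⟩ := exists_profile_ne_zero μ n
  have hne' : (profile μ n r₀ : ℂ) ≠ 0 := by exact_mod_cast hne
  refine ⟨L r₀ / profile μ n r₀, fun r hr => ?_⟩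
  have := eq_zero_of_radial_system (μ := μ) (n := n)
    (L := fun r => L r - L r₀ / profile μ n r₀ * profile μ n r)
    (P := fun r => P r - L r₀ / profile μ n r₀ * profileD μ n r)
    (fun r hr => by
      convert! (hL r hr).sub ((hρ r hr).const_mul (L r₀ / profile μ n r₀)) using 1
      ring)
    (fun r hr => by
      convert! (hP r hr).sub ((hρD r hr).const_mul (L r₀ / profile μ n r₀)) using 1
      ring) hr₀ (by field_simp; simp) (by
        have := hW r₀ hr₀
        field_simp
        linear_combination -this) hr
  exact ⟨sub_eq_zero.1 this.1, sub_eq_zero.1 this.2⟩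

theorem natAbs_cast_sq (k : ℤ) : (k.natAbs : ℂ) ^ 2 = (k : ℂ) ^ 2 := by
  rw [← Int.cast_natCast, ← Int.cast_pow, Int.natAbs_sq, Int.cast_pow]

theorem exists_circleCoeff_eq_mul_profile {f : ℂ → ℂ} {μ : ℝ} (hf : ContDiffOn ℝ 2 f (ball 0 1))
    (hΔ : ∀ z ∈ ball (0 : ℂ) 1, Δ f z = μ * f z) (k : ℤ) :
    ∃ A : ℂ, ∀ r ∈ Set.Ioo (0 : ℝ) 1, circleCoeff f k r = A * profile μ k.natAbs r ∧
      circleCoeffD f k r = A * profileD μ k.natAbs r := by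
  have hf1 : ContDiffOn ℝ 1 f (ball 0 1) := hf.of_le (by norm_num)
  refine exists_eq_mul_profile
    (fun r hr => (hasDerivAt_circleCoeff hf1 k hr).continuousAt.continuousWithinAt)
    (continuousOn_circleCoeffD hf k) (by simp [circleCoeffD])
    (fun r hr => hasDerivAt_circleCoeff' hf1 k hr) fun r hr => ?_
  rw [natAbs_cast_sq]
  exact hasDerivAt_circleCoeffD hf hΔ k hr

/-! ### Fourier coefficients up to the boundary: continuity, orthogonality, uniqueness. -/

theorem clip_mem (r : ℝ) : max 0 (min r 1) ∈ Set.Icc (0 : ℝ) 1 :=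
  ⟨le_max_left _ _, max_le zero_le_one (min_le_right _ _)⟩

theorem polar_mem_closedBall {r : ℝ} (hr : r ∈ Set.Icc (0 : ℝ) 1) (θ : ℝ) :
    (r : ℂ) * exp (I * θ) ∈ closedBall (0 : ℂ) 1 := by
  rw [mem_closedBall_zero_iff, norm_polar, abs_of_nonneg hr.1]
  exact hr.2

theorem continuous_comp_polar {g : ℂ → ℂ} (hg : ContinuousOn g (closedBall 0 1)) {r : ℝ}
    (hr : r ∈ Set.Icc (0 : ℝ) 1) : Continuous fun θ : ℝ => g (r * exp (I * θ)) :=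
  hg.comp_continuous (by fun_prop) (polar_mem_closedBall hr)

theorem continuousOn_circleCoeff {g : ℂ → ℂ} (hg : ContinuousOn g (closedBall 0 1)) (k : ℤ) :
    ContinuousOn (circleCoeff g k) (Set.Icc 0 1) := by
  -- Clipping the radius to `[0, 1]` makes the integrand continuous on the whole plane of
  -- parameters.
  have h : Continuous fun r : ℝ => circleCoeff g k (max 0 (min r 1)) := by
    refine intervalIntegral.continuous_parametric_intervalIntegral_of_continuous'
      (f := fun r θ => g ((max 0 (min r 1) : ℝ) * exp (I * θ)) * exp (-(I * k * θ))) ?_ _ _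
    refine Continuous.mul (hg.comp_continuous (f := fun p : ℝ × ℝ =>
      ((max 0 (min p.1 1) : ℝ) : ℂ) * exp (I * p.2)) (by fun_prop) fun p =>
        polar_mem_closedBall (clip_mem p.1) p.2) (by fun_prop)
  refine h.continuousOn.congr fun r hr => ?_
  beta_reduce
  rw [min_eq_left hr.2, max_eq_right hr.1]

theorem circleCoeff_sub {f g : ℂ → ℂ} {r : ℝ} (hf : Continuous fun θ : ℝ => f (r * exp (I * θ)))
    (hg : Continuous fun θ : ℝ => g (r * exp (I * θ))) (k : ℤ) :
    circleCoeff (fun z => f z - g z) k r = circleCoeff f k r - circleCoeff g k r := by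
  unfold circleCoeff
  rw [← intervalIntegral.integral_sub]
  · simp only [sub_mul]
  · exact (hf.mul (by fun_prop)).intervalIntegrable _ _
  · exact (hg.mul (by fun_prop)).intervalIntegrable _ _

theorem circleCoeff_sum {s : Finset ℤ} {f : ℤ → ℂ → ℂ}
    (hf : ∀ j ∈ s, ContinuousOn (f j) (closedBall 0 1)) (k : ℤ) {r : ℝ}
    (hr : r ∈ Set.Icc (0 : ℝ) 1) :
    circleCoeff (fun z => ∑ j ∈ s, f j z) k r = ∑ j ∈ s, circleCoeff (f j) k r := by
  unfold circleCoeff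
  rw [← intervalIntegral.integral_finsetSum]
  · simp only [Finset.sum_mul]
  · exact fun j hj => ((continuous_comp_polar (hf j hj) hr).mul (by fun_prop)).intervalIntegrable _ _

theorem integral_exp_mul_exp (j k : ℤ) :
    ∫ θ in (0 : ℝ)..2 * π, exp (I * j * θ) * exp (-(I * k * θ)) =
      if j = k then (2 * π : ℂ) else 0 := by
  split_ifs with h
  · subst h
    simp [← Complex.exp_add]
  · have hc : I * ((j : ℂ) - k) ≠ 0 := by
      refine mul_ne_zero Complex.I_ne_zero (sub_ne_zero.2 ?_)
      exact_mod_cast h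
    have e : ∀ θ : ℝ, exp (I * j * θ) * exp (-(I * k * θ)) = exp (I * ((j : ℂ) - k) * θ) := by
      intro θ
      rw [← Complex.exp_add]
      ring_nf
    simp only [e]
    rw [integral_exp_mul_complex hc]
    have hper : exp (I * ((j : ℂ) - k) * (2 * π : ℝ)) = 1 := by
      rw [Complex.exp_eq_one_iff]
      exact ⟨j - k, by push_cast; ring⟩
    rw [hper]
    simp

theorem circleCoeff_of_polar {f : ℂ → ℂ} {R : ℂ} {j : ℤ} {r : ℝ}
    (h : ∀ θ : ℝ, f (r * exp (I * θ)) = R * exp (I * j * θ)) (k : ℤ) :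
    circleCoeff f k r = if j = k then 2 * π * R else 0 := by
  unfold circleCoeff
  simp only [h, mul_assoc R]
  rw [intervalIntegral.integral_const_mul, integral_exp_mul_exp]
  split_ifs <;> ring

/-- The zero sequence is summable, so the Fourier series of this continuous function converges to it
pointwise, and that series is zero. -/
theorem eq_zero_of_circleCoeff_eq_zero {g : ℂ → ℂ} (hg : ContinuousOn g (closedBall 0 1)) {r : ℝ}
    (hr : r ∈ Set.Icc (0 : ℝ) 1) (h : ∀ k, circleCoeff g k r = 0) (θ : ℝ) :
    g (r * exp (I * θ)) = 0 := by
  have : Fact (0 < 2 * π) := ⟨by positivity⟩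
  have hcirc : ∀ x : ℝ, ((AddCircle.toCircle (x : AddCircle (2 * π)) : Circle) : ℂ) =
      exp (I * x) := fun x => by
    rw [AddCircle.toCircle_apply_mk, Circle.coe_exp, mul_comm I]
    congr 2
    have := Real.pi_ne_zero
    push_cast
    field_simp
  have hmem : ∀ x : AddCircle (2 * π),
      (r : ℂ) * (AddCircle.toCircle x : Circle) ∈ closedBall (0 : ℂ) 1 := fun x => by
    rw [mem_closedBall_zero_iff, norm_mul, Circle.norm_coe, mul_one, Complex.norm_real,
      Real.norm_of_nonneg hr.1]
    exact hr.2
  let F : C(AddCircle (2 * π), ℂ) := ⟨fun x => g (r * (AddCircle.toCircle x : Circle)),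
    hg.comp_continuous (continuous_const.mul (continuous_subtype_val.comp
      AddCircle.continuous_toCircle)) hmem⟩
  have hF : fourierCoeff F = 0 := by
    ext k
    rw [fourierCoeff_eq_intervalIntegral F k 0, zero_add]
    have : ∫ x in (0 : ℝ)..2 * π, fourier (-k) (x : AddCircle (2 * π)) • F x =
        circleCoeff g k r := by
      unfold circleCoeff
      congr 1 with x
      rw [fourier_coe_apply, smul_eq_mul, mul_comm]
      congr 1
      · simp only [F, ContinuousMap.coe_mk, hcirc]
      · congr 1
        have : (π : ℂ) ≠ 0 := by exact_mod_cast Real.pi_ne_zero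
        push_cast
        field_simp
    rw [this, h]
    simp
  have hs := has_pointwise_sum_fourier_series_of_summable (f := F) (by rw [hF]; exact summable_zero)
    (θ : AddCircle (2 * π))
  rw [hF] at hs
  have := hs.unique (by simpa only [Pi.zero_apply, zero_smul] using hasSum_zero)
  simpa only [F, ContinuousMap.coe_mk, hcirc] using this

/-! ### The modes `R(r)e^{ikθ}`: smoothness, boundary derivative, independence. -/

theorem exp_arg_of_mem_sphere {z : ℂ} (hz : z ∈ sphere (0 : ℂ) 1) : exp (I * z.arg) = z := by
  have := Complex.norm_mul_exp_arg_mul_I z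
  rw [mem_sphere_zero_iff_norm.1 hz] at this
  simpa [mul_comm] using this

/-- This removes the discontinuous `arg` and the nonsmooth norm, and so shows that a mode is smooth
on the whole plane. -/
theorem mode_eq (κ : ℝ) (k : ℤ) (α c d : ℝ) : mode κ k α c d = fun z =>
    ((c * (α / 2) ^ k.natAbs : ℝ) : ℂ) * helmholtzMode (-α ^ 2) k z +
      ((d * (κ / α / 2) ^ k.natAbs : ℝ) : ℂ) * helmholtzMode ((κ / α) ^ 2) k z := by
  funext z
  have hz : (‖z‖ : ℂ) * exp (I * z.arg) = z := by
    rw [mul_comm I, Complex.norm_mul_exp_arg_mul_I]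
  conv_rhs => rw [← hz]
  rw [helmholtzMode_polar, helmholtzMode_polar, mode, radial_eq]
  push_cast
  ring

theorem mode_polar (κ : ℝ) (k : ℤ) (α c d r θ : ℝ) :
    mode κ k α c d (r * exp (I * θ)) = radial κ k α c d r * exp (I * k * θ) := by
  rw [mode_eq]
  beta_reduce
  rw [helmholtzMode_polar, helmholtzMode_polar, radial_eq]
  push_cast
  ring

theorem contDiff_mode (κ : ℝ) (k : ℤ) (α c d : ℝ) (j : ℕ) : ContDiff ℝ j (mode κ k α c d) := by
  rw [mode_eq]
  exact (contDiff_const.mul (contDiff_helmholtzMode _ k j)).add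
    (contDiff_const.mul (contDiff_helmholtzMode _ k j))

theorem hasDerivAt_radial_one (κ : ℝ) (k : ℤ) (α c d : ℝ) :
    HasDerivAt (radial κ k α c d)
      (c * (α / 2) ^ k.natAbs * profileD (-α ^ 2) k.natAbs 1 +
        d * (κ / α / 2) ^ k.natAbs * profileD ((κ / α) ^ 2) k.natAbs 1) 1 := by
  rw [show radial κ k α c d = _ from funext (radial_eq κ k α c d)]
  have h1 := (hasDerivAt_profile (-α ^ 2) k.natAbs one_ne_zero).const_mul (c * (α / 2) ^ k.natAbs)
  have h2 := (hasDerivAt_profile ((κ / α) ^ 2) k.natAbs one_ne_zero).const_mul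
    (d * (κ / α / 2) ^ k.natAbs)
  simpa using! h1.add h2

theorem uniqueDiffWithinAt_closedBall {z : ℂ} (hz : z ∈ closedBall (0 : ℂ) 1) :
    UniqueDiffWithinAt ℝ (closedBall (0 : ℂ) 1) z :=
  uniqueDiffOn_convex (convex_closedBall 0 1)
    ⟨0, ball_subset_interior_closedBall (mem_ball_self one_pos)⟩ z hz

theorem fderivWithin_mode (κ : ℝ) (k : ℤ) (α c d θ : ℝ) :
    fderivWithin ℝ (mode κ k α c d) (closedBall 0 1) (exp (I * θ)) (exp (I * θ)) =
      deriv (radial κ k α c d) 1 * exp (I * k * θ) := by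
  have hd : DifferentiableAt ℝ (mode κ k α c d) (exp (I * θ)) :=
    (contDiff_mode κ k α c d 1).differentiable (by simp) _
  have hmem : exp (I * θ) ∈ closedBall (0 : ℂ) 1 := by simp
  rw [hd.fderivWithin (uniqueDiffWithinAt_closedBall hmem)]
  have h1 := (HasFDerivAt.comp_hasDerivAt (f := fun r : ℝ => (r : ℂ) * exp (I * θ)) (1 : ℝ)
    (by rw [Complex.ofReal_one, one_mul]; exact hd.hasFDerivAt) (hasDerivAt_polar_left 1 θ))
  have h2 := (hasDerivAt_radial_one κ k α c d).differentiableAt.hasDerivAt.ofReal_comp.mul_const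
    (exp (I * k * θ))
  rw [show (mode κ k α c d ∘ fun r : ℝ => (r : ℂ) * exp (I * θ)) =
    fun r : ℝ => (radial κ k α c d r : ℂ) * exp (I * k * θ) from
      funext fun r => mode_polar κ k α c d r θ] at h1
  exact h1.unique h2

theorem laplacian_add_helmholtzMode (μ ν : ℝ) (k : ℤ) (C D : ℂ) :
    Δ (fun z => C * helmholtzMode μ k z + D * helmholtzMode ν k z) =
      fun z => C * μ * helmholtzMode μ k z + D * ν * helmholtzMode ν k z := by
  funext z
  have h : ∀ μ, ContDiffAt ℝ 2 (helmholtzMode μ k) z := fun μ => by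
    exact_mod_cast (contDiff_helmholtzMode μ k 2).contDiffAt
  have h1 := ContDiffAt.laplacian_add (f₁ := C • helmholtzMode μ k) (f₂ := D • helmholtzMode ν k)
    (contDiffAt_const.smul (h μ)) (contDiffAt_const.smul (h ν))
  rw [laplacian_smul C (h μ), laplacian_smul D (h ν), laplacian_helmholtzMode,
    laplacian_helmholtzMode] at h1
  refine Eq.trans h1 ?_
  simp only [smul_eq_mul, mul_assoc]

/-- Eigenvectors of `Δ` for distinct eigenvalues are independent: applying `Δ` to the relation gives
a second one, and eliminating either term isolates the other. -/
theorem eq_zero_of_add_helmholtzMode_eq_zero {μ ν : ℝ} (hne : μ ≠ ν) {k : ℤ} {C D : ℂ}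
    (h : ∀ z ∈ ball (0 : ℂ) 1, C * helmholtzMode μ k z + D * helmholtzMode ν k z = 0) :
    C = 0 ∧ D = 0 := by
  have hΔ : ∀ z ∈ ball (0 : ℂ) 1,
      C * μ * helmholtzMode μ k z + D * ν * helmholtzMode ν k z = 0 := by
    intro z hz
    rw [← congrFun (laplacian_add_helmholtzMode μ ν k C D) z]
    have h0 : (fun z => C * helmholtzMode μ k z + D * helmholtzMode ν k z) =ᶠ[𝓝 z] fun _ => 0 :=
      eventually_of_mem (isOpen_ball.mem_nhds hz) h
    rw [(laplacian_congr_nhds h0).eq_of_nhds]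
    simp
  have hne' : (μ : ℂ) - ν ≠ 0 := sub_ne_zero.2 (by exact_mod_cast hne)
  have hex : ∀ μ : ℝ, ∃ z ∈ ball (0 : ℂ) 1, helmholtzMode μ k z ≠ 0 := fun μ => by
    obtain ⟨r, hr, hne⟩ := exists_profile_ne_zero μ k.natAbs
    refine ⟨r * exp (I * (0 : ℝ)), polar_mem_ball (Set.Ioo_subset_Ioo_left (by simp) hr) 0, ?_⟩
    rw [helmholtzMode_polar]
    exact mul_ne_zero (by exact_mod_cast hne) (Complex.exp_ne_zero _)
  constructor
  · obtain ⟨z, hz, hzne⟩ := hex μ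
    have : C * (((μ : ℂ) - ν) * helmholtzMode μ k z) = 0 := by
      linear_combination hΔ z hz - ν * h z hz
    exact (mul_eq_zero.1 this).resolve_right (mul_ne_zero hne' hzne)
  · obtain ⟨z, hz, hzne⟩ := hex ν
    have : D * (((μ : ℂ) - ν) * helmholtzMode ν k z) = 0 := by
      linear_combination μ * h z hz - hΔ z hz
    exact (mul_eq_zero.1 this).resolve_right (mul_ne_zero hne' hzne)

/-! ### Linearity of the clamped problem and the criterion for a mode. -/

section Solutions

variable {κ lam : ℝ}

theorem contDiffOn_laplacian {u : ℂ → ℂ} (hu : ContDiffOn ℝ 4 u (ball 0 1)) :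
    ContDiffOn ℝ 2 (Δ u) (ball 0 1) := by
  have e : Δ u = fun z => fderiv ℝ (fderiv ℝ u) z 1 1 + fderiv ℝ (fderiv ℝ u) z I I := by
    funext z
    simpa using norm_sq_mul_laplacian u z 1
  have h1 : ContDiffOn ℝ 3 (fderiv ℝ u) (ball 0 1) := hu.fderiv_of_isOpen isOpen_ball (by norm_num)
  have h2 : ContDiffOn ℝ 2 (fderiv ℝ (fderiv ℝ u)) (ball 0 1) :=
    h1.fderiv_of_isOpen isOpen_ball (by norm_num)
  rw [e]
  exact ((h2.clm_apply contDiffOn_const).clm_apply contDiffOn_const).add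
    ((h2.clm_apply contDiffOn_const).clm_apply contDiffOn_const)

theorem IsSolution.contDiffAt {u : ℂ → ℂ} (hu : IsSolution κ lam u) {z : ℂ}
    (hz : z ∈ ball (0 : ℂ) 1) : ContDiffAt ℝ 2 u z :=
  (hu.contDiffOn_ball.contDiffAt (isOpen_ball.mem_nhds hz)).of_le (by norm_num)

theorem IsSolution.contDiffAt_laplacian {u : ℂ → ℂ} (hu : IsSolution κ lam u) {z : ℂ}
    (hz : z ∈ ball (0 : ℂ) 1) : ContDiffAt ℝ 2 (Δ u) z :=
  (contDiffOn_laplacian hu.contDiffOn_ball).contDiffAt (isOpen_ball.mem_nhds hz)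

theorem IsSolution.differentiableWithinAt {u : ℂ → ℂ} (hu : IsSolution κ lam u) {z : ℂ}
    (hz : z ∈ sphere (0 : ℂ) 1) : DifferentiableWithinAt ℝ u (closedBall 0 1) z :=
  hu.contDiffOn_closedBall.differentiableOn (by simp) z (sphere_subset_closedBall hz)

theorem IsSolution.congr {u v : ℂ → ℂ} (hv : IsSolution κ lam v)
    (h : ∀ z ∈ closedBall (0 : ℂ) 1, u z = v z) : IsSolution κ lam u where
  contDiffOn_ball := hv.contDiffOn_ball.congr fun z hz => h z (ball_subset_closedBall hz)
  contDiffOn_closedBall := hv.contDiffOn_closedBall.congr h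
  equation z hz := by
    have h0 : u =ᶠ[𝓝 z] v := eventually_of_mem (isOpen_ball.mem_nhds hz)
      fun w hw => h w (ball_subset_closedBall hw)
    have h1 := laplacian_congr_nhds h0
    rw [(laplacian_congr_nhds h1).eq_of_nhds, h1.eq_of_nhds, h0.eq_of_nhds]
    exact hv.equation z hz
  boundary z hz := (h z (sphere_subset_closedBall hz)).trans (hv.boundary z hz)
  boundary_radial z hz := by
    rw [fderivWithin_congr h (h z (sphere_subset_closedBall hz))]
    exact hv.boundary_radial z hz

theorem isSolution_zero (κ lam : ℝ) : IsSolution κ lam fun _ => 0 where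
  contDiffOn_ball := contDiffOn_const
  contDiffOn_closedBall := contDiffOn_const
  equation z _ := by
    have : Δ (fun _ : ℂ => (0 : ℂ)) = fun _ => 0 := laplacian_const
    rw [this, this]
    simp
  boundary _ _ := rfl
  boundary_radial z _ := by simp

theorem IsSolution.add {u v : ℂ → ℂ} (hu : IsSolution κ lam u) (hv : IsSolution κ lam v) :
    IsSolution κ lam (u + v) where
  contDiffOn_ball := hu.contDiffOn_ball.add hv.contDiffOn_ball
  contDiffOn_closedBall := hu.contDiffOn_closedBall.add hv.contDiffOn_closedBall
  equation z hz := by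
    have h0 := (hu.contDiffAt hz).laplacian_add_nhds (hv.contDiffAt hz)
    rw [(laplacian_congr_nhds h0).eq_of_nhds, h0.eq_of_nhds,
      (hu.contDiffAt_laplacian hz).laplacian_add (hv.contDiffAt_laplacian hz), Pi.add_apply,
      Pi.add_apply]
    linear_combination hu.equation z hz + hv.equation z hz
  boundary z hz := by simp [hu.boundary z hz, hv.boundary z hz]
  boundary_radial z hz := by
    rw [fderivWithin_add (uniqueDiffWithinAt_closedBall (sphere_subset_closedBall hz))
      (hu.differentiableWithinAt hz) (hv.differentiableWithinAt hz), add_apply,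
      hu.boundary_radial z hz, hv.boundary_radial z hz, add_zero]

theorem IsSolution.smul {u : ℂ → ℂ} (a : ℂ) (hu : IsSolution κ lam u) :
    IsSolution κ lam (a • u) where
  contDiffOn_ball := contDiffOn_const.smul hu.contDiffOn_ball
  contDiffOn_closedBall := contDiffOn_const.smul hu.contDiffOn_closedBall
  equation z hz := by
    have h0 := laplacian_smul_nhds a (hu.contDiffAt hz)
    rw [(laplacian_congr_nhds h0).eq_of_nhds, h0.eq_of_nhds,
      laplacian_smul a (hu.contDiffAt_laplacian hz), Pi.smul_apply, Pi.smul_apply, smul_eq_mul,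
      smul_eq_mul, smul_eq_mul]
    linear_combination a * hu.equation z hz
  boundary z hz := by simp [hu.boundary z hz]
  boundary_radial z hz := by
    rw [fderivWithin_const_smul (uniqueDiffWithinAt_closedBall (sphere_subset_closedBall hz))
      (hu.differentiableWithinAt hz), smul_apply, hu.boundary_radial z hz, smul_zero]

theorem IsSolution.sum {s : Finset ℤ} {u : ℤ → ℂ → ℂ} (hu : ∀ k ∈ s, IsSolution κ lam (u k)) :
    IsSolution κ lam (∑ k ∈ s, u k) := by
  classical
  induction s using Finset.induction_on with
  | empty => exact isSolution_zero κ lam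
  | insert k s hk ih =>
    rw [Finset.sum_insert hk]
    exact (hu k (Finset.mem_insert_self k s)).add
      (ih fun j hj => hu j (Finset.mem_insert_of_mem hj))

theorem isEigenfunction_mode_iff (hκ : 0 < κ) (k : ℤ) {α c d : ℝ} (hα : 0 < α)
    (hcd : c ≠ 0 ∨ d ≠ 0) :
    IsEigenfunction κ lam (mode κ k α c d) ↔
      lam = α ^ 2 - κ ^ 2 / α ^ 2 ∧ radial κ k α c d 1 = 0 ∧ deriv (radial κ k α c d) 1 = 0 := by
  set C : ℝ := c * (α / 2) ^ k.natAbs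
  set D : ℝ := d * (κ / α / 2) ^ k.natAbs
  have hC : c ≠ 0 → C ≠ 0 := fun h => mul_ne_zero h (by positivity)
  have hD : d ≠ 0 → D ≠ 0 := fun h => mul_ne_zero h (by positivity)
  have hm : mode κ k α c d = fun z =>
    (C : ℂ) * helmholtzMode (-α ^ 2) k z + (D : ℂ) * helmholtzMode ((κ / α) ^ 2) k z :=
    mode_eq κ k α c d
  have hμν : -α ^ 2 ≠ (κ / α) ^ 2 := by
    have : 0 < (κ / α) ^ 2 := by positivity
    have : 0 < α ^ 2 := by positivity
    linarith
  -- On a `μ`-eigenfunction of `Δ` the operator is multiplication by `μ² + λμ - κ²`, here at `μ =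
  -- -α²` and `μ = (κ/α)²`. By independence, whichever of `C`, `D` is nonzero forces its factor to
  -- vanish.
  have hop : ∀ z, Δ (Δ (mode κ k α c d)) z - (κ : ℂ) ^ 2 * mode κ k α c d z +
      (lam : ℂ) * Δ (mode κ k α c d) z =
      ((C * (α ^ 4 - lam * α ^ 2 - κ ^ 2) : ℝ) : ℂ) * helmholtzMode (-α ^ 2) k z +
      ((D * ((κ / α) ^ 4 + lam * (κ / α) ^ 2 - κ ^ 2) : ℝ) : ℂ) *
        helmholtzMode ((κ / α) ^ 2) k z := by
    intro z
    rw [hm, laplacian_add_helmholtzMode, laplacian_add_helmholtzMode]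
    push_cast
    ring
  constructor
  · rintro ⟨hs, -⟩
    refine ⟨?_, ?_, ?_⟩
    · obtain ⟨h1, h2⟩ := eq_zero_of_add_helmholtzMode_eq_zero hμν fun z hz => by
        rw [← hop, hs.equation z hz, neg_mul, neg_add_cancel]
      norm_cast at h1 h2
      rcases hcd with h | h
      · have := (mul_eq_zero.1 h1).resolve_left (hC h)
        field_simp
        linear_combination -this
      · have := (mul_eq_zero.1 h2).resolve_left (hD h)
        have hfac : κ ^ 2 / α ^ 2 * (κ ^ 2 / α ^ 2 + lam - α ^ 2) = 0 := by
          rw [← this]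
          field_simp
        have := (mul_eq_zero.1 hfac).resolve_left (by positivity)
        linear_combination this
    -- The single boundary point `z = 1` already determines `R(1)` and `R'(1)`.
    · have := hs.boundary (exp (I * (0 : ℝ))) (by simp)
      have h2 := mode_polar κ k α c d 1 0
      rw [Complex.ofReal_one, one_mul, this] at h2
      simpa using h2.symm
    · have := hs.boundary_radial (exp (I * (0 : ℝ))) (by simp)
      rw [fderivWithin_mode] at this
      simpa using this
  · rintro ⟨rfl, h1, h2⟩
    refine ⟨⟨?_, ?_, ?_, ?_, ?_⟩, ?_⟩
    · exact_mod_cast (contDiff_mode κ k α c d 4).contDiffOn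
    · exact_mod_cast (contDiff_mode κ k α c d 1).contDiffOn
    · intro z _
      have := hop z
      have e1 : C * (α ^ 4 - (α ^ 2 - κ ^ 2 / α ^ 2) * α ^ 2 - κ ^ 2) = 0 := by
        field_simp
        ring
      have e2 : D * ((κ / α) ^ 4 + (α ^ 2 - κ ^ 2 / α ^ 2) * (κ / α) ^ 2 - κ ^ 2) = 0 := by
        field_simp
        ring
      rw [e1, e2] at this
      simp only [Complex.ofReal_zero, zero_mul, add_zero] at this
      linear_combination this
    · intro z hz
      have := mode_polar κ k α c d 1 z.arg
      rwa [Complex.ofReal_one, one_mul, exp_arg_of_mem_sphere hz, h1, Complex.ofReal_zero,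
        zero_mul] at this
    · intro z hz
      have := fderivWithin_mode κ k α c d z.arg
      rwa [exp_arg_of_mem_sphere hz, h2, Complex.ofReal_zero, zero_mul] at this
    · by_contra! hz
      obtain ⟨h1, h2⟩ := eq_zero_of_add_helmholtzMode_eq_zero (k := k) (C := C) (D := D) hμν
        fun z hz' => by
          rw [← hz z (ball_subset_closedBall hz'), hm]
      norm_cast at h1 h2
      exact hcd.elim (fun h => hC h h1) fun h => hD h h2

end Solutions

/-! ### Clamped profiles, the determinant condition, and the choice of `α`. -/

/-- The coefficient of `J_|k|` in the normalized profile that vanishes at `r = 1`. -/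
noncomputable def clampedC (k : ℤ) (α : ℝ) : ℝ := ((α / 2) ^ k.natAbs)⁻¹

/-- The coefficient of `I_|k|` in the normalized profile that vanishes at `r = 1`. -/
noncomputable def clampedD (κ : ℝ) (k : ℤ) (α : ℝ) : ℝ :=
  -(profile (-α ^ 2) k.natAbs 1 / profile ((κ / α) ^ 2) k.natAbs 1) *
    ((κ / α / 2) ^ k.natAbs)⁻¹

section Clamped

variable {κ α : ℝ}

theorem profile_one_pos {μ : ℝ} (hμ : 0 ≤ μ) (n : ℕ) : 0 < profile μ n 1 := by
  simpa [profile] using besselE_pos_of_nonneg n (by positivity : 0 ≤ μ / 4)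

theorem clampedC_ne_zero (hα : 0 < α) (k : ℤ) : clampedC k α ≠ 0 := by
  unfold clampedC
  positivity

theorem clampedC_mul (hα : 0 < α) (k : ℤ) : clampedC k α * (α / 2) ^ k.natAbs = 1 :=
  inv_mul_cancel₀ (by positivity)

theorem clampedD_mul (hκ : 0 < κ) (hα : 0 < α) (k : ℤ) :
    clampedD κ k α * (κ / α / 2) ^ k.natAbs =
      -(profile (-α ^ 2) k.natAbs 1 / profile ((κ / α) ^ 2) k.natAbs 1) := by
  rw [clampedD, mul_assoc, inv_mul_cancel₀ (by positivity), mul_one]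

theorem radial_clamped (hκ : 0 < κ) (hα : 0 < α) (k : ℤ) (r : ℝ) :
    radial κ k α (clampedC k α) (clampedD κ k α) r = profile (-α ^ 2) k.natAbs r -
      profile (-α ^ 2) k.natAbs 1 / profile ((κ / α) ^ 2) k.natAbs 1 *
        profile ((κ / α) ^ 2) k.natAbs r := by
  rw [radial_eq, clampedC_mul hα, clampedD_mul hκ hα]
  ring

theorem radial_clamped_one (hκ : 0 < κ) (hα : 0 < α) (k : ℤ) :
    radial κ k α (clampedC k α) (clampedD κ k α) 1 = 0 := by
  have := profile_one_pos (sq_nonneg (κ / α)) k.natAbs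
  rw [radial_clamped hκ hα, div_mul_cancel₀ _ this.ne', sub_self]

theorem deriv_radial_clamped_one (hκ : 0 < κ) (hα : 0 < α) {k : ℤ} (hF : charF κ k α = 0) :
    deriv (radial κ k α (clampedC k α) (clampedD κ k α)) 1 = 0 := by
  have := profile_one_pos (sq_nonneg (κ / α)) k.natAbs
  rw [(hasDerivAt_radial_one _ _ _ _ _).deriv, clampedC_mul hα, clampedD_mul hκ hα]
  have hF' := (charF_eq_zero_iff hκ hα k).1 hF
  generalize (κ / α) ^ 2 = ν at *
  field_simp
  linear_combination -hF'

theorem isEigenfunction_clamped (hκ : 0 < κ) (hα : 0 < α) {k : ℤ} (hF : charF κ k α = 0) :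
    IsEigenfunction κ (α ^ 2 - κ ^ 2 / α ^ 2) (mode κ k α (clampedC k α) (clampedD κ k α)) :=
  (isEigenfunction_mode_iff hκ k hα (.inl (clampedC_ne_zero hα k))).2
    ⟨rfl, radial_clamped_one hκ hα k, deriv_radial_clamped_one hκ hα hF⟩

theorem charF_eq_zero_iff_exists (hκ : 0 < κ) (hα : 0 < α) (k : ℤ) :
    charF κ k α = 0 ↔ ∃ c d : ℝ, (c ≠ 0 ∨ d ≠ 0) ∧ radial κ k α c d 1 = 0 ∧
      deriv (radial κ k α c d) 1 = 0 := by
  refine ⟨fun hF => ⟨_, _, .inl (clampedC_ne_zero hα k), radial_clamped_one hκ hα k,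
    deriv_radial_clamped_one hκ hα hF⟩, ?_⟩
  rintro ⟨c, d, hcd, h1, h2⟩
  rw [radial_eq] at h1
  rw [(hasDerivAt_radial_one _ _ _ _ _).deriv] at h2
  rw [charF_eq_zero_iff hκ hα, ← sub_eq_zero]
  have hp1 : (α / 2) ^ k.natAbs ≠ 0 := by positivity
  have hp2 : (κ / α / 2) ^ k.natAbs ≠ 0 := by positivity
  rcases hcd with h | h
  -- Cramer's rule: eliminating the other unknown leaves the determinant times a nonzero
  -- coefficient.
  · refine (mul_eq_zero.1 ?_).resolve_left (mul_ne_zero h hp1)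
    linear_combination profileD ((κ / α) ^ 2) k.natAbs 1 * h1 - profile ((κ / α) ^ 2) k.natAbs 1 * h2
  · refine (mul_eq_zero.1 ?_).resolve_left (mul_ne_zero h hp2)
    linear_combination -profileD (-α ^ 2) k.natAbs 1 * h1 + profile (-α ^ 2) k.natAbs 1 * h2

theorem exists_alpha (hκ : 0 < κ) (lam : ℝ) : ∃ α : ℝ, 0 < α ∧ lam = α ^ 2 - κ ^ 2 / α ^ 2 := by
  set s := √(lam ^ 2 + 4 * κ ^ 2)
  have hs : s ^ 2 = lam ^ 2 + 4 * κ ^ 2 := Real.sq_sqrt (by positivity)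
  have hpos : 0 < lam + s := by
    have : |lam| < s := by
      rw [← Real.sqrt_sq_eq_abs]
      exact Real.sqrt_lt_sqrt (sq_nonneg _) (by nlinarith [sq_pos_of_pos hκ])
    linarith [neg_abs_le lam]
  -- `α²` is the positive root of `x² - λx - κ² = 0`.
  refine ⟨√((lam + s) / 2), by positivity, ?_⟩
  rw [Real.sq_sqrt (by positivity)]
  field_simp
  linear_combination -hs

/-! ### Expansion of an arbitrary solution and the classification. -/

variable {lam : ℝ} {u : ℂ → ℂ}

theorem IsSolution.circleCoeff_eq_add (hκ : 0 < κ) (hα : 0 < α)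
    (hlam : lam = α ^ 2 - κ ^ 2 / α ^ 2) (hu : IsSolution κ lam u) (k : ℤ) :
    ∃ A B : ℂ, ∀ r ∈ Set.Ioo (0 : ℝ) 1, circleCoeff u k r =
      A * profile (-α ^ 2) k.natAbs r + B * profile ((κ / α) ^ 2) k.natAbs r := by
  have hu2 : ContDiffOn ℝ 2 u (ball 0 1) := hu.contDiffOn_ball.of_le (by norm_num)
  have hΔu := contDiffOn_laplacian hu.contDiffOn_ball
  have hlam' : (lam : ℂ) = (α : ℂ) ^ 2 - (κ / α : ℂ) ^ 2 := by
    rw [hlam]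
    push_cast
    ring
  have hprod : (α : ℂ) ^ 2 * (κ / α : ℂ) ^ 2 = (κ : ℂ) ^ 2 := by
    have : (α : ℂ) ≠ 0 := by exact_mod_cast hα.ne'
    field_simp
  -- The right side is a multiple of `Δu + tu` exactly for the two roots `t = -(κ/α)²` and `t = α²`,
  -- with multipliers `-α²` and `(κ/α)²`.
  have key : ∀ t : ℂ, ∀ z ∈ ball (0 : ℂ) 1,
      Δ (Δ u + t • u) z = (t - lam) * Δ u z + (κ : ℂ) ^ 2 * u z := fun t z hz => by
    rw [(hu.contDiffAt_laplacian hz).laplacian_add (f₂ := t • u) ((hu.contDiffAt hz).const_smul t),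
      laplacian_smul t (hu.contDiffAt hz), smul_eq_mul]
    linear_combination hu.equation z hz
  obtain ⟨A, hA⟩ := exists_circleCoeff_eq_mul_profile (f := Δ u + (-(κ / α : ℂ) ^ 2) • u)
    (μ := -α ^ 2) (hΔu.add (contDiffOn_const.smul hu2)) (fun z hz => by
      rw [key _ z hz, hlam', Pi.add_apply, Pi.smul_apply, smul_eq_mul]
      push_cast
      linear_combination (-u z) * hprod) k
  obtain ⟨B, hB⟩ := exists_circleCoeff_eq_mul_profile (f := Δ u + ((α : ℂ) ^ 2) • u)
    (μ := (κ / α) ^ 2) (hΔu.add (contDiffOn_const.smul hu2)) (fun z hz => by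
      rw [key _ z hz, hlam', Pi.add_apply, Pi.smul_apply, smul_eq_mul]
      push_cast
      linear_combination (-u z) * hprod) k
  have hγ : (α : ℂ) ^ 2 + (κ / α : ℂ) ^ 2 ≠ 0 := by
    have : 0 < α ^ 2 + (κ / α) ^ 2 := by positivity
    exact_mod_cast this.ne'
  refine ⟨-A / ((α : ℂ) ^ 2 + (κ / α : ℂ) ^ 2), B / ((α : ℂ) ^ 2 + (κ / α : ℂ) ^ 2), fun r hr => ?_⟩
  have hr' : r ∈ Set.Ioo (-1 : ℝ) 1 := Set.Ioo_subset_Ioo_left (by simp) hr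
  have hc : ∀ {g : ℂ → ℂ}, ContinuousOn g (ball 0 1) →
      Continuous fun θ : ℝ => g (r * exp (I * θ)) := fun hg =>
    hg.comp_continuous (by fun_prop) (polar_mem_ball hr')
  have h1 := hc (hΔu.continuousOn.add (hu2.continuousOn.const_smul ((α : ℂ) ^ 2)))
  have h2 := hc (hΔu.continuousOn.add (hu2.continuousOn.const_smul (-(κ / α : ℂ) ^ 2)))
  have e : circleCoeff u k r * ((α : ℂ) ^ 2 + (κ / α : ℂ) ^ 2) =
      circleCoeff (Δ u + ((α : ℂ) ^ 2) • u) k r -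
        circleCoeff (Δ u + (-(κ / α : ℂ) ^ 2) • u) k r := by
    rw [← circleCoeff_sub h1 h2, mul_comm, circleCoeff, circleCoeff,
      ← intervalIntegral.integral_const_mul]
    congr 1 with θ
    simp only [Pi.add_apply, Pi.smul_apply, smul_eq_mul]
    ring
  rw [(hA r hr).1, (hB r hr).1] at e
  rw [div_mul_eq_mul_div, div_mul_eq_mul_div, ← add_div, eq_div_iff hγ]
  linear_combination e

/-- Continuity carries the two-term formula and its radial derivative from `(0, 1)` to `r = 1`,
where the clamped conditions apply. As the `I`-profile is positive at `1`, the first condition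
expresses `B` through `A`; with the second, `A ≠ 0` forces the determinant to vanish. -/
theorem IsSolution.exists_circleCoeff_eq (hκ : 0 < κ) (hα : 0 < α)
    (hlam : lam = α ^ 2 - κ ^ 2 / α ^ 2) (hu : IsSolution κ lam u) (k : ℤ) :
    ∃ A : ℂ, (A ≠ 0 → charF κ k α = 0) ∧ ∀ r ∈ Set.Icc (0 : ℝ) 1,
      circleCoeff u k r = A * radial κ k α (clampedC k α) (clampedD κ k α) r := by
  obtain ⟨A, B, hAB⟩ := hu.circleCoeff_eq_add hκ hα hlam k
  have hc1 := continuous_profile (-α ^ 2) k.natAbs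
  have hc2 := continuous_profile ((κ / α) ^ 2) k.natAbs
  have hd1 := continuous_profileD (-α ^ 2) k.natAbs
  have hd2 := continuous_profileD ((κ / α) ^ 2) k.natAbs
  have hclos : closure (Set.Ioo (0 : ℝ) 1) = Set.Icc 0 1 := closure_Ioo (by norm_num)
  have hAB' : Set.EqOn (circleCoeff u k) (fun r =>
      A * profile (-α ^ 2) k.natAbs r + B * profile ((κ / α) ^ 2) k.natAbs r) (Set.Icc 0 1) :=
    Set.EqOn.of_subset_closure (s := Set.Ioo (0 : ℝ) 1) hAB
      (continuousOn_circleCoeff hu.contDiffOn_closedBall.continuousOn k)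
      (Continuous.continuousOn (by fun_prop)) Set.Ioo_subset_Icc_self hclos.ge
  -- `g` is `r ∂ᵣu`, continuous up to the circle; inside the disk its coefficients are `circleCoeffD
  -- u k`.
  set g : ℂ → ℂ := fun z => fderivWithin ℝ u (closedBall 0 1) z z
  have hg : ContinuousOn g (closedBall 0 1) :=
    (hu.contDiffOn_closedBall.continuousOn_fderivWithin
      (fun z hz => uniqueDiffWithinAt_closedBall hz) le_rfl).clm_apply continuousOn_id
  have hgD : Set.EqOn (circleCoeff g k) (fun r =>
      A * profileD (-α ^ 2) k.natAbs r + B * profileD ((κ / α) ^ 2) k.natAbs r) (Set.Icc 0 1) := by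
    refine Set.EqOn.of_subset_closure (s := Set.Ioo (0 : ℝ) 1) (fun r hr => ?_)
      (continuousOn_circleCoeff hg k)
      (Continuous.continuousOn (by fun_prop)) Set.Ioo_subset_Icc_self hclos.ge
    have hr0 : (r : ℂ) ≠ 0 := by exact_mod_cast hr.1.ne'
    have e1 : circleCoeff g k r = circleCoeffD u k r := by
      unfold circleCoeff circleCoeffD
      congr 1 with θ
      have hmem := polar_mem_ball (Set.Ioo_subset_Ioo_left (by simp) hr) θ
      simp only [g]
      rw [fderivWithin_of_mem_nhds (mem_of_superset (isOpen_ball.mem_nhds hmem)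
        ball_subset_closedBall)]
    have h1 := hasDerivAt_circleCoeff' (hu.contDiffOn_ball.of_le (by norm_num)) k hr
    have h2 := ((hasDerivAt_profile (-α ^ 2) k.natAbs hr.1.ne').ofReal_comp.const_mul A).add
      ((hasDerivAt_profile ((κ / α) ^ 2) k.natAbs hr.1.ne').ofReal_comp.const_mul B)
    have h3 := h1.unique (h2.congr_of_eventuallyEq
      (eventually_of_mem (isOpen_Ioo.mem_nhds hr) hAB))
    rw [e1]
    push_cast at h3
    rw [mul_div_assoc', mul_div_assoc', ← add_div, div_left_inj' hr0] at h3
    exact h3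
  have hb1 : A * profile (-α ^ 2) k.natAbs 1 + B * profile ((κ / α) ^ 2) k.natAbs 1 = 0 := by
    refine (hAB' (by simp : (1 : ℝ) ∈ Set.Icc (0 : ℝ) 1)).symm.trans ?_
    simp only [circleCoeff]
    simp [hu.boundary]
  have hb2 : A * profileD (-α ^ 2) k.natAbs 1 + B * profileD ((κ / α) ^ 2) k.natAbs 1 = 0 := by
    refine (hgD (by simp : (1 : ℝ) ∈ Set.Icc (0 : ℝ) 1)).symm.trans ?_
    simp only [circleCoeff, g]
    simp [hu.boundary_radial]
  have hpos := profile_one_pos (sq_nonneg (κ / α)) k.natAbs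
  have hne : (profile ((κ / α) ^ 2) k.natAbs 1 : ℂ) ≠ 0 := by exact_mod_cast hpos.ne'
  refine ⟨A, fun hA => ?_, fun r hr => ?_⟩
  · rw [charF_eq_zero_iff hκ hα]
    have : A * ((profile (-α ^ 2) k.natAbs 1 * profileD ((κ / α) ^ 2) k.natAbs 1 -
        profile ((κ / α) ^ 2) k.natAbs 1 * profileD (-α ^ 2) k.natAbs 1 : ℝ) : ℂ) = 0 := by
      push_cast
      linear_combination profileD ((κ / α) ^ 2) k.natAbs 1 * hb1 -
        profile ((κ / α) ^ 2) k.natAbs 1 * hb2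
    have := (mul_eq_zero.1 this).resolve_left hA
    exact sub_eq_zero.1 (by exact_mod_cast this)
  · rw [hAB' hr, radial_clamped hκ hα]
    push_cast
    generalize (κ / α) ^ 2 = ν at *
    field_simp
    linear_combination (profile ν k.natAbs r : ℂ) * hb1

theorem IsSolution.eq_sum_mode (hκ : 0 < κ) (hα : 0 < α)
    (hlam : lam = α ^ 2 - κ ^ 2 / α ^ 2) (hu : IsSolution κ lam u) :
    ∃ a : ℤ → ℂ, ∀ z ∈ closedBall (0 : ℂ) 1,
      u z = ∑ k ∈ (finite_setOf_charF_eq_zero hκ hα).toFinset,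
        a k * mode κ k α (clampedC k α) (clampedD κ k α) z := by
  choose A hA hAu using hu.exists_circleCoeff_eq hκ hα hlam
  -- `circleCoeff` is not divided by `2π`. Orders outside the finite set contribute nothing, since
  -- `F_k(α) ≠ 0` forces `A k = 0`.
  refine ⟨fun k => A k / (2 * π), fun z hz => ?_⟩
  set s := (finite_setOf_charF_eq_zero hκ hα).toFinset
  set f : ℤ → ℂ → ℂ := fun k z => A k / (2 * π) * mode κ k α (clampedC k α) (clampedD κ k α) z
  have hf : ∀ k ∈ s, ContinuousOn (f k) (closedBall 0 1) := fun k _ =>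
    (continuous_const.mul (contDiff_mode κ k α _ _ 0).continuous).continuousOn
  have huc := hu.contDiffOn_closedBall.continuousOn
  have hfc : ContinuousOn (fun z => ∑ k ∈ s, f k z) (closedBall 0 1) :=
    continuousOn_finsetSum s hf
  have hr : ‖z‖ ∈ Set.Icc (0 : ℝ) 1 := ⟨norm_nonneg z, by simpa using hz⟩
  have hcoef : ∀ k, circleCoeff (fun z => u z - ∑ j ∈ s, f j z) k ‖z‖ = 0 := by
    intro k
    rw [circleCoeff_sub (continuous_comp_polar huc hr) (continuous_comp_polar hfc hr),
      circleCoeff_sum hf k hr, hAu k _ hr]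
    have hfk : ∀ j, circleCoeff (f j) k ‖z‖ = if j = k then
        A k * (radial κ k α (clampedC k α) (clampedD κ k α) ‖z‖ : ℂ) else 0 := by
      intro j
      rw [circleCoeff_of_polar (R := A j / (2 * π) *
        (radial κ j α (clampedC j α) (clampedD κ j α) ‖z‖ : ℂ)) (j := j) (fun θ => by
        simp only [f, mode_polar]
        ring)]
      have hπ : (π : ℂ) ≠ 0 := by exact_mod_cast Real.pi_ne_zero
      split_ifs with h
      · subst h
        field_simp
      · rfl
    simp only [hfk, Finset.sum_ite_eq']
    split_ifs with hk
    · exact sub_self _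
    · have : A k = 0 := by
        by_contra hne
        exact hk ((Set.Finite.mem_toFinset _).2 (hA k hne))
      simp [this]
  have h0 := eq_zero_of_circleCoeff_eq_zero (huc.sub hfc) hr hcoef z.arg
  rw [mul_comm I, Complex.norm_mul_exp_arg_mul_I] at h0
  exact sub_eq_zero.1 h0

theorem IsEigenfunction.exists_radial_eq (hκ : 0 < κ) (hu : IsEigenfunction κ lam u) {k : ℤ}
    {R : ℝ → ℝ} (hR : ∀ r ∈ Set.Icc (0 : ℝ) 1, ∀ θ : ℝ,
      u ((r : ℂ) * exp (I * θ)) = (R r : ℂ) * exp (I * k * θ)) :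
    ∃ α c d : ℝ, 0 < α ∧ charF κ k α = 0 ∧ lam = α ^ 2 - κ ^ 2 / α ^ 2 ∧
      (c ≠ 0 ∨ d ≠ 0) ∧ ∀ r ∈ Set.Icc (0 : ℝ) 1, R r = radial κ k α c d r := by
  obtain ⟨α, hα, hlam⟩ := exists_alpha hκ lam
  obtain ⟨A, hA, hAu⟩ := hu.1.exists_circleCoeff_eq hκ hα hlam k
  -- `A` may a priori be complex, but both profiles are real, so comparing real parts yields a real
  -- factor; it is absorbed into `c` and `d`.
  have hRA : ∀ r ∈ Set.Icc (0 : ℝ) 1,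
      R r = (A / (2 * π)).re * radial κ k α (clampedC k α) (clampedD κ k α) r := by
    intro r hr
    have h := hAu r hr
    rw [circleCoeff_of_polar (hR r hr), if_pos rfl] at h
    have hπ : (π : ℂ) ≠ 0 := by exact_mod_cast Real.pi_ne_zero
    have h' : (R r : ℂ) =
        A / (2 * π) * (radial κ k α (clampedC k α) (clampedD κ k α) r : ℂ) := by
      field_simp
      linear_combination h
    simpa using congrArg Complex.re h'
  obtain ⟨z, hz, hne⟩ := hu.2
  have hr : ‖z‖ ∈ Set.Icc (0 : ℝ) 1 := ⟨norm_nonneg z, by simpa using hz⟩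
  have hRz := hR ‖z‖ hr z.arg
  rw [mul_comm I, Complex.norm_mul_exp_arg_mul_I, hRA _ hr] at hRz
  have ht : (A / (2 * π)).re ≠ 0 := by
    intro h0
    rw [h0] at hRz
    simp [hne] at hRz
  have hA0 : A ≠ 0 := by
    rintro rfl
    simp at ht
  refine ⟨α, (A / (2 * π)).re * clampedC k α, (A / (2 * π)).re * clampedD κ k α, hα, hA hA0, hlam,
    .inl (mul_ne_zero ht (clampedC_ne_zero hα k)), fun r hr => ?_⟩
  rw [hRA r hr, radial, radial]
  ring

theorem isEigenfunction_iff_eq_sum_mode (hκ : 0 < κ) : IsEigenfunction κ lam u ↔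
    (∃ z ∈ closedBall (0 : ℂ) 1, u z ≠ 0) ∧
      ∃ α : ℝ, 0 < α ∧ lam = α ^ 2 - κ ^ 2 / α ^ 2 ∧
        ∃ (s : Finset ℤ) (a : ℤ → ℂ) (c d : ℤ → ℝ),
          (∀ k ∈ s, charF κ k α = 0 ∧ IsEigenfunction κ lam (mode κ k α (c k) (d k))) ∧
          ∀ z ∈ closedBall (0 : ℂ) 1, u z = ∑ k ∈ s, a k * mode κ k α (c k) (d k) z := by
  constructor
  · rintro ⟨hu, hne⟩
    obtain ⟨α, hα, hlam⟩ := exists_alpha hκ lam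
    obtain ⟨a, ha⟩ := hu.eq_sum_mode hκ hα hlam
    refine ⟨hne, α, hα, hlam, _, a, fun k => clampedC k α, fun k => clampedD κ k α,
      fun k hk => ?_, ha⟩
    have hF : charF κ k α = 0 := by simpa using hk
    exact ⟨hF, hlam ▸ isEigenfunction_clamped hκ hα hF⟩
  · rintro ⟨hne, α, -, -, s, a, c, d, hs, hu⟩
    refine ⟨(IsSolution.sum (u := fun k => a k • mode κ k α (c k) (d k))
      fun k hk => (hs k hk).2.1.smul (a k)).congr fun z hz => ?_, hne⟩
    simp [hu z hz]

theorem isEigenvalue_iff (hκ : 0 < κ) : IsEigenvalue κ lam ↔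
    ∃ (k : ℤ) (α : ℝ), 0 < α ∧ charF κ k α = 0 ∧ lam = α ^ 2 - κ ^ 2 / α ^ 2 := by
  constructor
  · rintro ⟨u, hu⟩
    obtain ⟨⟨z, hz, hne⟩, α, hα, hlam, s, a, c, d, hs, hsum⟩ :=
      (isEigenfunction_iff_eq_sum_mode hκ).1 hu
    rw [hsum z hz] at hne
    -- A nonzero value of `u` needs a nonempty sum; any order occurring in it supplies a root of
    -- `F_k`.
    obtain ⟨k, hk, -⟩ := Finset.exists_ne_zero_of_sum_ne_zero hne
    exact ⟨k, α, hα, (hs k hk).1, hlam⟩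
  · rintro ⟨k, α, hα, hF, rfl⟩
    exact ⟨_, isEigenfunction_clamped hκ hα hF⟩

end Clamped

end ClampedDisk

theorem proposition3p1 (κ : ℝ) (hκ : 0 < κ) :
    -- every positive root of `F_k` gives nontrivial real coefficients meeting the clamped
    -- conditions at `r = 1`, and only roots of `F_k` do
    (∀ (k : ℤ) (α : ℝ), 0 < α →
      (ClampedDisk.charF κ k α = 0 ↔
        ∃ c d : ℝ, (c ≠ 0 ∨ d ≠ 0) ∧ ClampedDisk.radial κ k α c d 1 = 0 ∧
          deriv (ClampedDisk.radial κ k α c d) 1 = 0)) ∧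
    -- `R(r) e^{ikθ}` is an eigenfunction exactly under these conditions, and the corresponding
    -- eigenvalue is `α² - κ²/α²`
    (∀ (k : ℤ) (α c d lam : ℝ), 0 < α → (c ≠ 0 ∨ d ≠ 0) →
      (ClampedDisk.IsEigenfunction κ lam (ClampedDisk.mode κ k α c d) ↔
        lam = α ^ 2 - κ ^ 2 / α ^ 2 ∧ ClampedDisk.radial κ k α c d 1 = 0 ∧
          deriv (ClampedDisk.radial κ k α c d) 1 = 0)) ∧
    -- every eigenfunction of the form `R(r) e^{ikθ}` has the stated `R`
    (∀ (k : ℤ) (R : ℝ → ℝ) (lam : ℝ) (u : ℂ → ℂ), ClampedDisk.IsEigenfunction κ lam u →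
      (∀ r ∈ Set.Icc (0 : ℝ) 1, ∀ θ : ℝ,
        u ((r : ℂ) * Complex.exp (Complex.I * (θ : ℂ))) =
          (R r : ℂ) * Complex.exp (Complex.I * (k : ℂ) * (θ : ℂ))) →
      ∃ α c d : ℝ, 0 < α ∧ ClampedDisk.charF κ k α = 0 ∧ lam = α ^ 2 - κ ^ 2 / α ^ 2 ∧
        (c ≠ 0 ∨ d ≠ 0) ∧ ∀ r ∈ Set.Icc (0 : ℝ) 1, R r = ClampedDisk.radial κ k α c d r) ∧
    -- there are no others: the eigenfunctions for `lam` are exactly the nonzero finite linear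
    -- combinations of these, all with one and the same `α`
    (∀ (lam : ℝ) (u : ℂ → ℂ), ClampedDisk.IsEigenfunction κ lam u ↔
      (∃ z ∈ Metric.closedBall (0 : ℂ) 1, u z ≠ 0) ∧
      ∃ α : ℝ, 0 < α ∧ lam = α ^ 2 - κ ^ 2 / α ^ 2 ∧
        ∃ (s : Finset ℤ) (a : ℤ → ℂ) (c d : ℤ → ℝ),
          (∀ k ∈ s, ClampedDisk.charF κ k α = 0 ∧
            ClampedDisk.IsEigenfunction κ lam (ClampedDisk.mode κ k α (c k) (d k))) ∧
          ∀ z ∈ Metric.closedBall (0 : ℂ) 1,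
            u z = ∑ k ∈ s, a k * ClampedDisk.mode κ k α (c k) (d k) z) ∧
    -- the eigenvalues
    (∀ lam : ℝ, ClampedDisk.IsEigenvalue κ lam ↔
      ∃ (k : ℤ) (α : ℝ), 0 < α ∧ ClampedDisk.charF κ k α = 0 ∧
        lam = α ^ 2 - κ ^ 2 / α ^ 2) := by
  exact ⟨fun k α hα => ClampedDisk.charF_eq_zero_iff_exists hκ hα k,
    fun k α c d lam hα hcd => ClampedDisk.isEigenfunction_mode_iff hκ k hα hcd,
    fun k R lam u hu hR => hu.exists_radial_eq hκ hR,
    fun lam u => ClampedDisk.isEigenfunction_iff_eq_sum_mode hκ,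
    fun lam => ClampedDisk.isEigenvalue_iff hκ⟩
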